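/- All graphs are finite and simple. A graph is outerplanar if it has a planar drawing (vertices are distinct points, edges are simple arcs meeting only in common ends) in which all vertices lie on the boundary of the outer face. Three edges $e_1,e_2,e_3$ are consecutive if they form, in this order, a path with three edges or a triangle. An injective edge-coloring of a graph is a (not necessarily proper) coloring $c$ of its edges such that $c(e_1)\neq c(e_3)$ whenever $e_1,e_2,e_3$ are consecutive, and $\chi'_{\mathrm{inj}}(G)$ is the least number of colors in an injective edge-coloring of $G$. A path $v_1v_2\cdots v_k$ in $G$ (with pairwise distinct vertices) is simple if $v_2,\dots,v_{k-1}$ all have degree $2$ in $G$; its length is its number of edges. Theorem. Let $G$ be an outerplanar graph with maximum degree $\Delta(G)=3$. (a) $\chi'_{\mathrm{inj}}(G)\le 5$. (b) If no connected component of $G$ is a cycle of odd length at least $5$ (in particular, if $G$ is connected), then $G$ has an injective edge-coloring with at most $5$ colors such that on every simple path of length three exactly two colors appear. (c) The bound in (a) is tight. Let $G_0$ be the graph on the twelve vertices $u,u_1,\dots,u_5,v,v_1,\dots,v_5$ whose edges are $uv$, together with $uu_1,\,uu_2,\,u_1u_2,\,u_1u_5,\,u_2u_3,\,u_3u_5,\,u_3u_4,\,u_4u_5$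 and $vv_1,\,vv_2,\,v_1v_2,\,v_1v_5,\,v_2v_3,\,v_3v_5,\,v_3v_4,\,v_4v_5$. Then $G_0$ is outerplanar, $\Delta(G_0)=3$ and $\chi'_{\mathrm{inj}}(G_0)=5$. -/

import Mathlib

open SimpleGraph

/-! ### Planar and outerplanar drawings (the plane is `ℂ`) -/

/-- `A` is an arc in the plane with endpoints `a` and `b`: the image of an injective path. -/
def IsArcBetween (A : Set ℂ) (a b : ℂ) : Prop :=
  ∃ γ : Path a b, Function.Injective γ ∧ Set.range γ = A

/-- A planar drawing of `G`: vertices are distinct points, every edge is an arc joining its two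
ends, an arc contains no vertex other than its ends, and two different arcs meet at most in
common ends. The values of `arc` outside the edge set of `G` are irrelevant. -/
structure PlanarDrawing {V : Type*} (G : SimpleGraph V) where
  point : V → ℂ
  arc : Sym2 V → Set ℂ
  point_injective : Function.Injective point
  isArc : ∀ u v : V, G.Adj u v → IsArcBetween (arc s(u, v)) (point u) (point v)
  mem_of_point_mem_arc : ∀ e ∈ G.edgeSet, ∀ w : V, point w ∈ arc e → w ∈ e
  arc_inter_arc : ∀ e ∈ G.edgeSet, ∀ f ∈ G.edgeSet, e ≠ f →
    arc e ∩ arc f ⊆ point '' {w | w ∈ e ∧ w ∈ f}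

namespace PlanarDrawing

variable {V : Type*} {G : SimpleGraph V}

/-- The set of all points of the drawing. -/
def carrier (D : PlanarDrawing G) : Set ℂ :=
  Set.range D.point ∪ ⋃ e ∈ G.edgeSet, D.arc e

/-- A face is a connected component of the complement of the drawing. -/
def IsFace (D : PlanarDrawing G) (F : Set ℂ) : Prop :=
  ∃ z ∈ D.carrierᶜ, F = connectedComponentIn D.carrierᶜ z

/-- The outer face is the unbounded face. -/
def IsOuterFace (D : PlanarDrawing G) (F : Set ℂ) : Prop :=
  D.IsFace F ∧ ¬ Bornology.IsBounded F

end PlanarDrawing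

/-- A graph is outerplanar if it has a planar drawing in which all vertices lie on the boundary
of the outer face. -/
def IsOuterplanar {V : Type*} (G : SimpleGraph V) : Prop :=
  ∃ (D : PlanarDrawing G) (F : Set ℂ), D.IsOuterFace F ∧ ∀ v : V, D.point v ∈ frontier F

/-! ### Injective edge-colorings -/

/-- The edges `uv`, `vw`, `wx` are consecutive: they form a path with three edges
(if `u ≠ x`) or a triangle (if `u = x`). -/
def Consecutive {V : Type*} (G : SimpleGraph V) (u v w x : V) : Prop :=
  G.Adj u v ∧ G.Adj v w ∧ G.Adj w x ∧ u ≠ w ∧ v ≠ x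

/-- An edge-coloring is injective if the first and the third of any three consecutive edges
have different colors. It need not be proper. -/
def IsInjectiveEdgeColoring {V K : Type*} (G : SimpleGraph V) (c : G.edgeSet → K) : Prop :=
  ∀ (u v w x : V) (h : Consecutive G u v w x), c ⟨s(u, v), h.1⟩ ≠ c ⟨s(w, x), h.2.2.1⟩

/-- The injective chromatic index: the least `k` such that `G` has an injective edge-coloring
with `k` colors (`⊤` if there is none). -/
noncomputable def injChromaticIndex {V : Type*} (G : SimpleGraph V) : ℕ∞ :=
  ⨅ k ∈ {k : ℕ | ∃ c : G.edgeSet → Fin k, IsInjectiveEdgeColoring G c}, (k : ℕ∞)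

/-- A path of `G` (with pairwise distinct vertices) is simple if all its interior vertices have
degree two in `G`. -/
def IsSimplePath {V : Type*} (G : SimpleGraph V) [G.LocallyFinite] {u v : V}
    (p : G.Walk u v) : Prop :=
  p.IsPath ∧ ∀ w ∈ p.support, w ≠ u → w ≠ v → G.degree w = 2

/-- In every simple path of length three, exactly two colors appear. -/
def TwoColorsOnSimplePaths {V K : Type*} (G : SimpleGraph V) [G.LocallyFinite]
    (c : G.edgeSet → K) : Prop :=
  ∀ (u v : V) (p : G.Walk u v), IsSimplePath G p → p.length = 3 →
    (c '' {e : G.edgeSet | (e : Sym2 V) ∈ p.edges}).ncard = 2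

/-- No connected component of `G` is a cycle of odd length at least five. -/
def NoLongOddCycleComponent {V : Type*} (G : SimpleGraph V) : Prop :=
  ∀ (C : G.ConnectedComponent) (n : ℕ), Odd n → 5 ≤ n →
    IsEmpty (C.toSimpleGraph ≃g cycleGraph n)

/-! ### The extremal graph -/

/-- The edges of the graph on the twelve vertices `u, u₁, …, u₅` (numbered `0, …, 5`) and
`v, v₁, …, v₅` (numbered `6, …, 11`). It consists of the edge `uv` and two copies of a 6-vertex
graph, in which a triangle `u u₁ u₂`, a 4-cycle `u₁ u₂ u₃ u₅` and a triangle `u₃ u₄ u₅` are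
glued along the edges `u₁u₂` and `u₃u₅`. -/
def twelveEdges : Finset (Sym2 (Fin 12)) :=
  {s(0, 6),
   s(0, 1), s(0, 2), s(1, 2), s(1, 5), s(2, 3), s(3, 5), s(3, 4), s(4, 5),
   s(6, 7), s(6, 8), s(7, 8), s(7, 11), s(8, 9), s(9, 11), s(9, 10), s(10, 11)}

/-- The graph on twelve vertices with the above edges. -/
def twelveGraph : SimpleGraph (Fin 12) where
  Adj a b := s(a, b) ∈ twelveEdges
  symm := ⟨fun a b h => by rwa [Sym2.eq_swap]⟩
  loopless := ⟨by decide⟩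

instance : DecidableRel twelveGraph.Adj :=
  fun a b => inferInstanceAs (Decidable (s(a, b) ∈ twelveEdges))

/-! ### Crossing numbers of continuous paths modulo two -/

/-! Topology enters only through excluded minors. A point of the outer face can be joined to all
vertices, so a `K₄` or `K₂,₃` minor of an outerplanar graph would give a drawing of `K₅` or `K₃,₃`
with disjoint independent edges. No Jordan curve theorem is needed to exclude this: the difference
of two disjoint paths is a nonvanishing function on a square, and its continuous logarithm yields a
relation between winding integers (`exists_crossing_relation`). Summed over all pairs of independent
edges, each integer occurs twice, while the convex drawing has an odd number of crossings.

The coloring is built by induction on the graph. A graph with an edge has a vertex of degree one or,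
by `exists_end_cycle`, a cycle whose vertices all have degree two except perhaps two adjacent ones,
`p 0` and `p m`. One deletes the pendant edge, or the ear from `p 0` to `p m`, keeping the edge `p 0
p m`. Along the ear, edges are essentially colored in equal consecutive pairs, which gives
injectivity and two colors on simple paths at once. At the ends a crude count of forbidden colors is
too large by one. The saving comes from the two-color condition itself: when both ends have further
neighbors in the smaller graph, either these coincide, or `p 0 p m` is the middle edge of a simple
path and repeats the color of an adjacent edge. So the condition in (b) is what makes the induction
work, even for (a).

An isolated odd cycle of length at least five has no two-color coloring, since its edges would split
into equal pairs. The induction therefore carries a set `Z` of edges exempt from the condition as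
middle edges, which must meet every such component. Deletions may isolate new odd cycles; exempting
edges at an attachment vertex repairs this, and the extension step deals with those edges in the
larger graph. Taking `Z` to be everything gives (a), and `Z = ∅` gives (b).

For tightness, four colors on one half of the extremal graph force the color of the bridge onto
another edge at its end (`color_bridge_eq`). This happens at both ends, and the two edges found are
separated only by the bridge. -/

theorem exists_continuous_log {X : Type*} [TopologicalSpace X] [SimplyConnectedSpace X]
    [LocallyPathConnectedSpace X] (g : C(X, ℂ)) (hg : ∀ x, g x ≠ 0) :
    ∃ L : C(X, ℂ), ∀ x, Complex.exp (L x) = g x := by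
  obtain ⟨x₀⟩ : Nonempty X := inferInstance
  obtain ⟨L, ⟨-, hL⟩, -⟩ := Complex.isCoveringMapOn_exp.existsUnique_continuousMap_lifts g
    (a₀ := x₀) (Complex.exp_log (hg x₀)) hg
  exact ⟨L, fun x => congrFun hL x⟩

theorem log_change_unique {L₁ L₂ : C(ℝ, ℂ)}
    (h : ∀ t, Complex.exp (L₁ t) = Complex.exp (L₂ t)) (s t : ℝ) :
    L₁ t - L₁ s = L₂ t - L₂ s := by
  obtain ⟨L, -, hL⟩ := Complex.isCoveringMapOn_exp.existsUnique_continuousMap_lifts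
    (⟨fun t => Complex.exp (L₁ t), by fun_prop⟩ : C(ℝ, ℂ)) (a₀ := s) (e₀ := L₁ s) rfl
    (fun a => Complex.exp_ne_zero _)
  have h₁ := hL L₁ ⟨rfl, rfl⟩
  have h₂ := hL ⟨fun t => L₂ t + (L₁ s - L₂ s), by fun_prop⟩ ⟨by simp, by
    funext t
    have : Complex.exp (L₁ s - L₂ s) = 1 := by
      rw [Complex.exp_sub, h s, div_self (Complex.exp_ne_zero _)]
    simp [Complex.exp_add, this, h t]⟩
  have := congrArg (fun F : C(ℝ, ℂ) => F t) (h₁.trans h₂.symm)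
  simp only [ContinuousMap.coe_mk] at this
  rw [this]
  ring

/-- With logarithms fixed at both endpoints, the change of argument along the path around `w` is
determined up to one integer, which does not depend on the lift `L`. This is a relative winding
number. -/
theorem exists_log_change (γ : C(ℝ, ℂ)) (w a b : ℂ) (ha : Complex.exp a = γ 0 - w)
    (hb : Complex.exp b = γ 1 - w) (hw : ∀ t, γ t ≠ w) :
    ∃ n : ℤ, ∀ L : C(ℝ, ℂ), (∀ t, Complex.exp (L t) = γ t - w) →
      L 1 - L 0 = b - a + n * (2 * Real.pi * Complex.I) := by
  obtain ⟨L₀, hL₀⟩ := exists_continuous_log (⟨fun t => γ t - w, by fun_prop⟩ : C(ℝ, ℂ))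
    (fun t => sub_ne_zero.2 (hw t))
  simp only [ContinuousMap.coe_mk] at hL₀
  obtain ⟨m, hm⟩ := Complex.exp_eq_exp_iff_exists_int.1 ((hL₀ 0).trans ha.symm)
  obtain ⟨k, hk⟩ := Complex.exp_eq_exp_iff_exists_int.1 ((hL₀ 1).trans hb.symm)
  refine ⟨k - m, fun L hL => ?_⟩
  rw [log_change_unique (fun t => (hL t).trans (hL₀ t).symm) 0 1, hm, hk]
  push_cast
  ring

/-- To a family of paths between points in the plane belong integers satisfying, for every two
disjoint paths, a relation whose right-hand side is the crossing number of the two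
chords when the points are put on a circle in the given order. -/
theorem exists_crossing_relation {ι : Type*} [LinearOrder ι] (p : ι → ℂ)
    (γ : ∀ i j, Path (p i) (p j)) :
    ∃ N : ι → ι → ι → ℤ, ∀ a b c d, Disjoint (Set.range (γ a b)) (Set.range (γ c d)) →
      N a b c + N c d b - N a b d - N c d a =
        2 - ((if b < c then 1 else 0) + (if c < a then 1 else 0) +
          (if d < b then 1 else 0) + (if a < d then 1 else 0)) := by
  -- Logarithms of `p y - p x` for which swapping `x` and `y` costs exactly `±πi`, the sign being
  -- read off from the order of the indices. The crossing term of the convex drawing arises from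
  -- these signs.
  set l : ι → ι → ℂ := fun x y =>
    if x < y then Complex.log (p y - p x) else Complex.log (p x - p y) + Real.pi * Complex.I
    with hl
  have hexp : ∀ x y, p x ≠ p y → Complex.exp (l x y) = p y - p x := by
    intro x y hxy
    simp only [hl]
    split_ifs
    · exact Complex.exp_log (sub_ne_zero.2 hxy.symm)
    · rw [Complex.exp_add, Complex.exp_log (sub_ne_zero.2 hxy), Complex.exp_pi_mul_I]
      ring
  have hsym : ∀ x y, x ≠ y →
      l x y - l y x = ((2 * (if y < x then 1 else 0) - 1 : ℤ) : ℂ) * (Real.pi * Complex.I) := by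
    intro x y hxy
    simp only [hl]
    rcases lt_or_gt_of_ne hxy with h | h
    · rw [if_pos h, if_neg h.not_gt, if_neg h.not_gt]
      push_cast
      ring
    · rw [if_pos h, if_neg h.not_gt, if_pos h]
      push_cast
      ring
  -- Constant extension to `ℝ` lets logarithms be lifted over `ℝ` and `ℝ × ℝ`; only the unit square
  -- matters.
  let e : ∀ i j, C(ℝ, ℂ) := fun i j => ⟨(γ i j).extend, (γ i j).continuous_extend⟩
  have he0 : ∀ i j, e i j 0 = p i := fun i j => (γ i j).extend_zero
  have he1 : ∀ i j, e i j 1 = p j := fun i j => (γ i j).extend_one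
  have her : ∀ i j t, e i j t ∈ Set.range (γ i j) := fun i j t =>
    (γ i j).extend_range ▸ Set.mem_range_self t
  have h0r : ∀ i j, p i ∈ Set.range (γ i j) := fun i j => ⟨0, (γ i j).source⟩
  have h1r : ∀ i j, p j ∈ Set.range (γ i j) := fun i j => ⟨1, (γ i j).target⟩
  have hN : ∀ a b w, ∃ n : ℤ, p w ∉ Set.range (γ a b) → ∀ L : C(ℝ, ℂ),
      (∀ t, Complex.exp (L t) = e a b t - p w) →
        L 1 - L 0 = l w b - l w a + n * (2 * Real.pi * Complex.I) := by
    intro a b w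
    by_cases hw : p w ∈ Set.range (γ a b)
    · exact ⟨0, fun h => absurd hw h⟩
    · obtain ⟨n, hn⟩ := exists_log_change (e a b) (p w) (l w a) (l w b)
        (by rw [he0]; exact hexp _ _ fun h => hw (by rw [h]; exact h0r a b))
        (by rw [he1]; exact hexp _ _ fun h => hw (by rw [h]; exact h1r a b))
        (fun t h => hw (h ▸ her a b t))
      exact ⟨n, fun _ => hn⟩
  choose N hN using hN
  refine ⟨N, fun a b c d hd => ?_⟩
  have hne : ∀ x ∈ Set.range (γ a b), ∀ y ∈ Set.range (γ c d), x ≠ y := fun x hx y hy h =>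
    Set.disjoint_left.1 hd hx (h ▸ hy)
  -- The changes of this single logarithm around the four sides of the unit square cancel. On the
  -- two sides along `γ c d` the difference has the opposite sign, hence the shifts by `πi`.
  obtain ⟨L, hL⟩ := exists_continuous_log
    (⟨fun x : ℝ × ℝ => e a b x.1 - e c d x.2, by fun_prop⟩ : C(ℝ × ℝ, ℂ))
    (fun x => sub_ne_zero.2 (hne _ (her _ _ _) _ (her _ _ _)))
  simp only [ContinuousMap.coe_mk] at hL
  have e1 := hN a b c (fun h => hne _ h _ (h0r c d) rfl) ⟨fun t => L (t, 0), by fun_prop⟩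
    (fun t => by simp [hL, he0])
  have e2 := hN a b d (fun h => hne _ h _ (h1r c d) rfl) ⟨fun t => L (t, 1), by fun_prop⟩
    (fun t => by simp [hL, he1])
  have e3 := hN c d b (fun h => hne _ (h1r a b) _ h rfl)
    ⟨fun t => L (1, t) + Real.pi * Complex.I, by fun_prop⟩
    (fun t => by simp [hL, he1, Complex.exp_add])
  have e4 := hN c d a (fun h => hne _ (h0r a b) _ h rfl)
    ⟨fun t => L (0, t) + Real.pi * Complex.I, by fun_prop⟩
    (fun t => by simp [hL, he0, Complex.exp_add])
  simp only [ContinuousMap.coe_mk] at e1 e2 e3 e4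
  have s1 := hsym c b fun h => hne _ (h1r a b) _ (h0r c d) (h ▸ rfl)
  have s2 := hsym a c fun h => hne _ (h0r a b) _ (h0r c d) (h ▸ rfl)
  have s3 := hsym b d fun h => hne _ (h1r a b) _ (h1r c d) (h ▸ rfl)
  have s4 := hsym d a fun h => hne _ (h0r a b) _ (h1r c d) (h ▸ rfl)
  have key : (((2 * (if b < c then 1 else 0) - 1) + (2 * (if c < a then 1 else 0) - 1) +
      (2 * (if d < b then 1 else 0) - 1) + (2 * (if a < d then 1 else 0) - 1) +
      2 * (N a b c + N c d b - N a b d - N c d a) : ℤ) : ℂ) * (Real.pi * Complex.I) = 0 := by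
    rw [Int.cast_add, Int.cast_add, Int.cast_add, Int.cast_add, add_mul, add_mul, add_mul,
      add_mul, ← s1, ← s2, ← s3, ← s4]
    push_cast
    linear_combination e2 + e4 - e1 - e3
  have hpi : (Real.pi * Complex.I : ℂ) ≠ 0 := by simp [Real.pi_ne_zero]
  have := Int.cast_eq_zero.1 ((mul_eq_zero.1 key).resolve_right hpi)
  linarith

/-- The complete graph on five points cannot be drawn so that independent edges are disjoint. -/
theorem not_exists_drawing_five (p : Fin 5 → ℂ) (γ : ∀ i j, Path (p i) (p j))
    (h : ∀ a b c d, a < b → c < d → a ≠ c → a ≠ d → b ≠ c → b ≠ d →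
      Disjoint (Set.range (γ a b)) (Set.range (γ c d))) : False := by
  obtain ⟨N, hN⟩ := exists_crossing_relation p γ
  have key : ∀ a b c d : Fin 5, a < b → c < d → a ≠ c → a ≠ d → b ≠ c → b ≠ d → _ :=
    fun a b c d h1 h2 h3 h4 h5 h6 => hN a b c d (h a b c d h1 h2 h3 h4 h5 h6)
  have e1 := key 0 1 2 3 (by decide) (by decide) (by decide) (by decide) (by decide) (by decide)
  have e2 := key 0 1 2 4 (by decide) (by decide) (by decide) (by decide) (by decide) (by decide)
  have e3 := key 0 1 3 4 (by decide) (by decide) (by decide) (by decide) (by decide) (by decide)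
  have e4 := key 0 2 1 3 (by decide) (by decide) (by decide) (by decide) (by decide) (by decide)
  have e5 := key 0 2 1 4 (by decide) (by decide) (by decide) (by decide) (by decide) (by decide)
  have e6 := key 0 2 3 4 (by decide) (by decide) (by decide) (by decide) (by decide) (by decide)
  have e7 := key 0 3 1 2 (by decide) (by decide) (by decide) (by decide) (by decide) (by decide)
  have e8 := key 0 3 1 4 (by decide) (by decide) (by decide) (by decide) (by decide) (by decide)
  have e9 := key 0 3 2 4 (by decide) (by decide) (by decide) (by decide) (by decide) (by decide)
  have e10 := key 0 4 1 2 (by decide) (by decide) (by decide) (by decide) (by decide) (by decide)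
  have e11 := key 0 4 1 3 (by decide) (by decide) (by decide) (by decide) (by decide) (by decide)
  have e12 := key 0 4 2 3 (by decide) (by decide) (by decide) (by decide) (by decide) (by decide)
  have e13 := key 1 2 3 4 (by decide) (by decide) (by decide) (by decide) (by decide) (by decide)
  have e14 := key 1 3 2 4 (by decide) (by decide) (by decide) (by decide) (by decide) (by decide)
  have e15 := key 1 4 2 3 (by decide) (by decide) (by decide) (by decide) (by decide) (by decide)
  -- Every integer `N i j k` that occurs does so in exactly two of the fifteen relations, and
  -- exactly five right-hand sides are `1`, the others `0`: a contradiction modulo two.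
  simp (decide := true) only [if_true, if_false] at e1 e2 e3 e4 e5 e6 e7 e8 e9 e10 e11 e12 e13 e14 e15
  omega

/-- The graph `K₃,₃` cannot be drawn so that independent edges are disjoint. -/
theorem not_exists_drawing_three_three (p : Fin 6 → ℂ) (γ : ∀ i j, Path (p i) (p j))
    (h : ∀ a b c d, a < 3 → 3 ≤ b → c < 3 → 3 ≤ d → a ≠ c → b ≠ d →
      Disjoint (Set.range (γ a b)) (Set.range (γ c d))) : False := by
  obtain ⟨N, hN⟩ := exists_crossing_relation p γ
  have key : ∀ a b c d : Fin 6, a < 3 → 3 ≤ b → c < 3 → 3 ≤ d → a ≠ c → b ≠ d → _ :=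
    fun a b c d h1 h2 h3 h4 h5 h6 => hN a b c d (h a b c d h1 h2 h3 h4 h5 h6)
  have e1 := key 0 3 1 4 (by decide) (by decide) (by decide) (by decide) (by decide) (by decide)
  have e2 := key 0 3 1 5 (by decide) (by decide) (by decide) (by decide) (by decide) (by decide)
  have e3 := key 0 3 2 4 (by decide) (by decide) (by decide) (by decide) (by decide) (by decide)
  have e4 := key 0 3 2 5 (by decide) (by decide) (by decide) (by decide) (by decide) (by decide)
  have e5 := key 0 4 1 3 (by decide) (by decide) (by decide) (by decide) (by decide) (by decide)
  have e6 := key 0 4 1 5 (by decide) (by decide) (by decide) (by decide) (by decide) (by decide)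
  have e7 := key 0 4 2 3 (by decide) (by decide) (by decide) (by decide) (by decide) (by decide)
  have e8 := key 0 4 2 5 (by decide) (by decide) (by decide) (by decide) (by decide) (by decide)
  have e9 := key 0 5 1 3 (by decide) (by decide) (by decide) (by decide) (by decide) (by decide)
  have e10 := key 0 5 1 4 (by decide) (by decide) (by decide) (by decide) (by decide) (by decide)
  have e11 := key 0 5 2 3 (by decide) (by decide) (by decide) (by decide) (by decide) (by decide)
  have e12 := key 0 5 2 4 (by decide) (by decide) (by decide) (by decide) (by decide) (by decide)
  have e13 := key 1 3 2 4 (by decide) (by decide) (by decide) (by decide) (by decide) (by decide)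
  have e14 := key 1 3 2 5 (by decide) (by decide) (by decide) (by decide) (by decide) (by decide)
  have e15 := key 1 4 2 3 (by decide) (by decide) (by decide) (by decide) (by decide) (by decide)
  have e16 := key 1 4 2 5 (by decide) (by decide) (by decide) (by decide) (by decide) (by decide)
  have e17 := key 1 5 2 3 (by decide) (by decide) (by decide) (by decide) (by decide) (by decide)
  have e18 := key 1 5 2 4 (by decide) (by decide) (by decide) (by decide) (by decide) (by decide)
  -- The same parity argument: nine of the eighteen right-hand sides are `1`.
  simp (decide := true) only [if_true, if_false] at e1 e2 e3 e4 e5 e6 e7 e8 e9 e10 e11 e12 e13 e14 e15 e16 e17 e18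
  omega

/-! ### Outerplanar graphs have no `K₄` minor and no `K₂,₃` minor -/

section Minors

variable {V : Type*} {G : SimpleGraph V}

/-- The set `A` of vertices is nonempty and induces a connected subgraph of `G`. -/
def ConnectedIn (G : SimpleGraph V) (A : Set V) : Prop :=
  A.Nonempty ∧ ∀ a ∈ A, ∀ b ∈ A,
    Relation.ReflTransGen (fun u v => G.Adj u v ∧ u ∈ A ∧ v ∈ A) a b

/-- The sets `A i` are the branch sets of a model of `K` as a minor of `G`. -/
structure IsMinorModel {ι : Type*} (K : SimpleGraph ι) (G : SimpleGraph V) (A : ι → Set V) :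
    Prop where
  connectedIn : ∀ i, ConnectedIn G (A i)
  disjoint : ∀ i j, i ≠ j → Disjoint (A i) (A j)
  exists_adj : ∀ i j, K.Adj i j → ∃ a ∈ A i, ∃ b ∈ A j, G.Adj a b

/-- `K` is a minor of `G`. -/
def HasMinor {ι : Type*} (K : SimpleGraph ι) (G : SimpleGraph V) : Prop :=
  ∃ A : ι → Set V, IsMinorModel K G A

theorem ConnectedIn.mono {H : SimpleGraph V} (h : H ≤ G) {A : Set V} (hA : ConnectedIn H A) :
    ConnectedIn G A :=
  ⟨hA.1, fun a ha b hb => Relation.ReflTransGen.mono (fun _ _ hr => ⟨h hr.1, hr.2⟩) _ _ (hA.2 a ha b hb)⟩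

theorem HasMinor.mono {ι : Type*} {K : SimpleGraph ι} {H : SimpleGraph V} (h : H ≤ G)
    (hK : HasMinor K H) : HasMinor K G := by
  obtain ⟨A, hA⟩ := hK
  refine ⟨A, fun i => (hA.connectedIn i).mono h, hA.disjoint, fun i j hij => ?_⟩
  obtain ⟨a, ha, b, hb, hab⟩ := hA.exists_adj i j hij
  exact ⟨a, ha, b, hb, h hab⟩

namespace PlanarDrawing

/-- The part of a drawing formed by the vertices in `A` and the edges with both ends in `A`. -/
def region (D : PlanarDrawing G) (A : Set V) : Set ℂ :=
  D.point '' A ∪ ⋃ e ∈ {e ∈ G.edgeSet | ∀ w ∈ e, w ∈ A}, D.arc e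

theorem point_mem_region (D : PlanarDrawing G) {A : Set V} {a : V} (ha : a ∈ A) :
    D.point a ∈ D.region A :=
  Or.inl ⟨a, ha, rfl⟩

theorem arc_subset_region (D : PlanarDrawing G) {A : Set V} {a b : V} (h : G.Adj a b)
    (ha : a ∈ A) (hb : b ∈ A) : D.arc s(a, b) ⊆ D.region A := fun z hz => by
  refine Or.inr (Set.mem_biUnion (x := s(a, b)) ⟨h, ?_⟩ hz)
  intro w hw
  rcases Sym2.mem_iff.1 hw with rfl | rfl <;> assumption

theorem region_mono (D : PlanarDrawing G) {A B : Set V} (h : A ⊆ B) :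
    D.region A ⊆ D.region B := by
  refine Set.union_subset_union (Set.image_mono h) ?_
  exact Set.biUnion_mono (fun e he => ⟨he.1, fun w hw => h (he.2 w hw)⟩) fun _ _ => subset_rfl

theorem region_subset_carrier (D : PlanarDrawing G) (A : Set V) :
    D.region A ⊆ D.carrier := by
  refine Set.union_subset_union (Set.image_subset_range _ _) ?_
  exact Set.biUnion_mono (fun e he => he.1) fun _ _ => subset_rfl

theorem disjoint_region (D : PlanarDrawing G) {A B : Set V} (h : Disjoint A B) :
    Disjoint (D.region A) (D.region B) := by
  rw [Set.disjoint_left] at h ⊢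
  rintro z (⟨a, ha, rfl⟩ | hz) (⟨b, hb, hab⟩ | hz')
  · exact h ha (D.point_injective hab ▸ hb)
  · obtain ⟨e, he, hz'⟩ := Set.mem_iUnion₂.1 hz'
    exact h ha (he.2 a (D.mem_of_point_mem_arc e he.1 a hz'))
  · obtain ⟨e, he, hz⟩ := Set.mem_iUnion₂.1 hz
    exact h (he.2 b (D.mem_of_point_mem_arc e he.1 b (hab ▸ hz))) hb
  · obtain ⟨e, he, hz⟩ := Set.mem_iUnion₂.1 hz
    obtain ⟨f, hf, hz'⟩ := Set.mem_iUnion₂.1 hz'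
    have hef : e ≠ f := by
      rintro rfl
      obtain ⟨x, y⟩ := e
      exact h (he.2 x (Sym2.mem_mk_left x y)) (hf.2 x (Sym2.mem_mk_left x y))
    obtain ⟨w, ⟨hwe, hwf⟩, -⟩ := D.arc_inter_arc e he.1 f hf.1 hef ⟨hz, hz'⟩
    exact h (he.2 w hwe) (hf.2 w hwf)

theorem joinedIn_region (D : PlanarDrawing G) {A : Set V} {a b : V} (ha : a ∈ A)
    (h : Relation.ReflTransGen (fun u v => G.Adj u v ∧ u ∈ A ∧ v ∈ A) a b) :
    JoinedIn (D.region A) (D.point a) (D.point b) := by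
  induction h with
  | refl => exact JoinedIn.refl (D.point_mem_region ha)
  | @tail u v _ huv ih =>
    refine ih.trans ?_
    obtain ⟨γ, -, hγ⟩ := D.isArc u v huv.1
    exact ⟨γ, fun t => D.arc_subset_region huv.1 huv.2.1 huv.2.2 (hγ ▸ Set.mem_range_self t)⟩

theorem isCompact_arc (D : PlanarDrawing G) {e : Sym2 V} (he : e ∈ G.edgeSet) :
    IsCompact (D.arc e) := by
  obtain ⟨x, y⟩ := e
  obtain ⟨γ, -, hγ⟩ := D.isArc x y he
  exact (show IsCompact (D.arc s(x, y)) from hγ ▸ isCompact_range γ.continuous)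

theorem isClosed_region [Finite V] (D : PlanarDrawing G) (A : Set V) :
    IsClosed (D.region A) := by
  refine ((Set.toFinite A).image _).isClosed.union ?_
  exact (Set.toFinite _).isClosed_biUnion fun e he => (D.isCompact_arc he.1).isClosed

theorem carrier_eq_region (D : PlanarDrawing G) : D.carrier = D.region Set.univ := by
  simp [carrier, region]

/-- A face is open and path connected, so `h` can be joined inside it to a point near the vertex; a
segment in a small ball finishes the path. The ball misses all vertices and edges avoiding `v`.
Edges at `v` may be crossed, which is harmless since only independent edges must stay disjoint. -/
theorem IsFace.exists_path [Finite V] {D : PlanarDrawing G} {F : Set ℂ} (hF : D.IsFace F)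
    {h : ℂ} (hh : h ∈ F) {v : V} (hv : D.point v ∈ frontier F) :
    ∃ γ : Path h (D.point v), ∀ A, v ∉ A → Disjoint (Set.range γ) (D.region A) := by
  have hopen : IsOpen D.carrierᶜ := by
    rw [carrier_eq_region]
    exact (D.isClosed_region _).isOpen_compl
  have hFc : F ⊆ D.carrierᶜ := by
    obtain ⟨z, -, rfl⟩ := hF
    exact connectedComponentIn_subset _ _
  have hFp : IsPathConnected F := by
    obtain ⟨z, hz, rfl⟩ := hF
    exact hopen.connectedComponentIn.isConnected_iff_isPathConnected.1
      (isConnected_connectedComponentIn_iff.2 hz)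
  have hvK : D.point v ∈ (D.region {v}ᶜ)ᶜ := fun hmem =>
    Set.disjoint_left.1 (D.disjoint_region (A := {v}) (B := {v}ᶜ) (by simp))
      (D.point_mem_region rfl) hmem
  obtain ⟨ε, hε, hball⟩ := Metric.isOpen_iff.1 (D.isClosed_region {v}ᶜ).isOpen_compl _ hvK
  obtain ⟨z, hzF, hzε⟩ := Metric.mem_closure_iff.1 (frontier_subset_closure hv) ε hε
  have hsub : F ⊆ (D.region {v}ᶜ)ᶜ := fun x hx hx' =>
    hFc hx (D.region_subset_carrier _ hx')
  have hseg : JoinedIn (Metric.ball (D.point v) ε) z (D.point v) :=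
    JoinedIn.of_segment_subset ((convex_ball _ _).segment_subset
      (by rwa [Metric.mem_ball'])  (Metric.mem_ball_self hε))
  obtain ⟨γ, hγ⟩ := ((hFp.joinedIn h hh z hzF).mono hsub).trans (hseg.mono hball)
  refine ⟨γ, fun A hA => ?_⟩
  rw [Set.disjoint_left]
  rintro _ ⟨t, rfl⟩ ht
  exact hγ t (D.region_mono (Set.subset_compl_singleton_iff.2 hA) ht)

end PlanarDrawing

/-- If `K` is a minor of an outerplanar graph, then `K` together with a new vertex joined to all
vertices of `K` has a drawing in which independent edges are disjoint. -/
theorem IsOuterplanar.exists_cone_drawing [Finite V] (hG : IsOuterplanar G) {ι : Type*}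
    {K : SimpleGraph ι} (hK : HasMinor K G) :
    ∃ (h : ℂ) (p : ι → ℂ) (γ : ∀ i, Path h (p i)) (δ : ∀ i j, Path (p i) (p j)),
      (∀ i j k, K.Adj j k → i ≠ j → i ≠ k → Disjoint (Set.range (γ i)) (Set.range (δ j k))) ∧
      ∀ i j k l, K.Adj i j → K.Adj k l → i ≠ k → i ≠ l → j ≠ k → j ≠ l →
        Disjoint (Set.range (δ i j)) (Set.range (δ k l)) := by
  obtain ⟨D, F, hF, hfr⟩ := hG
  obtain ⟨A, hA⟩ := hK
  choose a ha using fun i => (hA.connectedIn i).1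
  obtain ⟨h, hh, hFh⟩ := hF.1
  have hhF : h ∈ F := hFh ▸ mem_connectedComponentIn hh
  choose γ hγ using fun i => hF.1.exists_path hhF (hfr (a i))
  have hδ : ∀ i j, ∃ δ : Path (D.point (a i)) (D.point (a j)),
      K.Adj i j → Set.range δ ⊆ D.region (A i ∪ A j) := by
    intro i j
    by_cases hij : K.Adj i j
    · obtain ⟨x, hx, y, hy, hxy⟩ := hA.exists_adj i j hij
      have h1 := (hA.connectedIn i).2 _ (ha i) x hx
      have h2 := (hA.connectedIn j).2 y hy _ (ha j)
      obtain ⟨δ, hδ⟩ := D.joinedIn_region (A := A i ∪ A j) (Or.inl (ha i))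
        (((Relation.ReflTransGen.mono (fun _ _ h => ⟨h.1, Or.inl h.2.1, Or.inl h.2.2⟩) _ _ h1).tail
          ⟨hxy, Or.inl hx, Or.inr hy⟩).trans
            (Relation.ReflTransGen.mono (fun _ _ h => ⟨h.1, Or.inr h.2.1, Or.inr h.2.2⟩) _ _ h2))
      exact ⟨δ, fun _ => Set.range_subset_iff.2 hδ⟩
    · exact ⟨(γ i).symm.trans (γ j), fun h => absurd h hij⟩
  choose δ hδ using hδ
  refine ⟨h, fun i => D.point (a i), γ, δ, fun i j k hjk hij hik => ?_,
    fun i j k l hij hkl hik hil hjk hjl => ?_⟩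
  · refine (hγ i (A j ∪ A k) ?_).mono_right (hδ j k hjk)
    rintro (hm | hm)
    · exact Set.disjoint_left.1 (hA.disjoint i j hij) (ha i) hm
    · exact Set.disjoint_left.1 (hA.disjoint i k hik) (ha i) hm
  · refine (D.disjoint_region ?_).mono (hδ i j hij) (hδ k l hkl)
    simp only [Set.disjoint_union_left, Set.disjoint_union_right]
    exact ⟨⟨hA.disjoint _ _ hik, hA.disjoint _ _ hjk⟩, hA.disjoint _ _ hil, hA.disjoint _ _ hjl⟩

theorem IsOuterplanar.not_hasMinor_completeGraph_four [Finite V] (hG : IsOuterplanar G) :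
    ¬ HasMinor (completeGraph (Fin 4)) G := by
  intro hK
  obtain ⟨h, p, γ, δ, h1, h2⟩ := hG.exists_cone_drawing hK
  let p' : Fin 5 → ℂ := Fin.cons h p
  let γ' : ∀ i j, Path (p' i) (p' j) := fun i j =>
    Fin.cases (motive := fun i => Path (p' i) (p' j))
      (Fin.cases (motive := fun j => Path (p' 0) (p' j)) (Path.refl h) (fun j => γ j) j)
      (fun i => Fin.cases (motive := fun j => Path (p' i.succ) (p' j)) (γ i).symm
        (fun j => δ i j) j) i
  refine not_exists_drawing_five p' γ' fun a b c d hab hcd hac had hbc hbd => ?_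
  obtain ⟨b, rfl⟩ := Fin.exists_succ_eq_of_ne_zero (Fin.ne_zero_of_lt hab)
  obtain ⟨d, rfl⟩ := Fin.exists_succ_eq_of_ne_zero (Fin.ne_zero_of_lt hcd)
  induction a using Fin.cases with
  | zero =>
    obtain ⟨c, rfl⟩ := Fin.exists_succ_eq_of_ne_zero hac.symm
    exact h1 b c d (by rintro rfl; exact lt_irrefl _ hcd) (fun h => hbc (h ▸ rfl))
      (fun h => hbd (h ▸ rfl))
  | succ a =>
    induction c using Fin.cases with
    | zero =>
      exact (h1 d a b (by rintro rfl; exact lt_irrefl _ hab) (fun h => had (h ▸ rfl))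
        (fun h => hbd (h ▸ rfl))).symm
    | succ c =>
      exact h2 a b c d (by rintro rfl; exact lt_irrefl _ hab) (by rintro rfl; exact lt_irrefl _ hcd)
        (fun h => hac (h ▸ rfl)) (fun h => had (h ▸ rfl)) (fun h => hbc (h ▸ rfl))
        (fun h => hbd (h ▸ rfl))

theorem IsOuterplanar.not_hasMinor_two_three [Finite V] (hG : IsOuterplanar G) :
    ¬ HasMinor (completeBipartiteGraph (Fin 2) (Fin 3)) G := by
  intro hK
  obtain ⟨h, p, γ, δ, h1, h2⟩ := hG.exists_cone_drawing hK
  -- The apex joins the side with two vertices, so the classes of `K₃,₃` are `0, 1, 2` and `3, 4,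
  -- 5`.
  let p' : Fin 6 → ℂ := ![h, p (.inl 0), p (.inl 1), p (.inr 0), p (.inr 1), p (.inr 2)]
  have hex : ∀ i j, ∃ ε : Path (p' i) (p' j), i < 3 → 3 ≤ j → ∃ l : Fin 3, j = l.natAdd 3 ∧
      (i = 0 ∧ Set.range ε = Set.range (γ (.inr l)) ∨
        ∃ k : Fin 2, i = k.succ.castAdd 3 ∧ Set.range ε = Set.range (δ (.inl k) (.inr l))) := by
    intro i j
    by_cases hij : i < 3 ∧ 3 ≤ j
    · obtain ⟨l, rfl⟩ : ∃ l : Fin 3, j = l.natAdd 3 :=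
        ⟨⟨j - 3, by omega⟩, by
          have : 3 ≤ j.val := hij.2
          ext; simp; omega⟩
      have hl : p' (l.natAdd 3) = p (.inr l) := by fin_cases l <;> rfl
      induction i using Fin.cases with
      | zero =>
        exact ⟨(γ (.inr l)).cast rfl hl, fun _ _ => ⟨l, rfl, Or.inl ⟨rfl, rfl⟩⟩⟩
      | succ i =>
        obtain ⟨k, rfl⟩ : ∃ k : Fin 2, i = k.castAdd 3 :=
          ⟨⟨i, by have : i.val + 1 < 3 := hij.1; omega⟩, rfl⟩
        have hk : p' (k.castAdd 3).succ = p (.inl k) := by fin_cases k <;> rfl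
        exact ⟨(δ (.inl k) (.inr l)).cast hk hl, fun _ _ => ⟨l, rfl, Or.inr ⟨k, rfl, rfl⟩⟩⟩
    · exact ⟨PathConnectedSpace.somePath _ _, fun h h' => absurd ⟨h, h'⟩ hij⟩
  choose ε hε using hex
  refine not_exists_drawing_three_three p' ε fun a b c d ha hb hc hd hac hbd => ?_
  obtain ⟨l, rfl, hl⟩ := hε a b ha hb
  obtain ⟨m, rfl, hm⟩ := hε c d hc hd
  have hlm : l ≠ m := fun h => hbd (h ▸ rfl)
  have hlm' : (Sum.inr l : Fin 2 ⊕ Fin 3) ≠ Sum.inr m := fun h => hlm (Sum.inr_injective h)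
  rcases hl with ⟨rfl, hl⟩ | ⟨i, rfl, hl⟩ <;> rcases hm with ⟨rfl, hm⟩ | ⟨j, rfl, hm⟩
  · exact absurd rfl hac
  · rw [hl, hm]
    exact h1 _ _ _ (by simp) (by simp) hlm'
  · rw [hl, hm]
    exact (h1 _ _ _ (by simp) (by simp) hlm'.symm).symm
  · rw [hl, hm]
    exact h2 _ _ _ _ (by simp) (by simp) (fun h => hac (by rw [Sum.inl_injective h])) (by simp)
      (by simp) hlm'

end Minors

/-! ### Ends of outerplanar graphs -/

section Structure

variable {V : Type*} {G : SimpleGraph V}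

theorem connectedIn_of_forall_reflTransGen {A : Set V} {s : V} (hs : s ∈ A)
    (h : ∀ a ∈ A, Relation.ReflTransGen (fun u v => G.Adj u v ∧ u ∈ A ∧ v ∈ A) s a) :
    ConnectedIn G A := by
  refine ⟨⟨s, hs⟩, fun a ha b hb => .trans ?_ (h b hb)⟩
  have : Std.Symm (fun u v => G.Adj u v ∧ u ∈ A ∧ v ∈ A) :=
    ⟨fun u v h => ⟨h.1.symm, h.2.2, h.2.1⟩⟩
  exact Relation.ReflTransGen.stdSymm.symm _ _ (h a ha)

theorem connectedIn_image_Icc {P : ℕ → V} (hP : ∀ t, G.Adj (P t) (P (t + 1))) {i j : ℕ}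
    (hij : i ≤ j) : ConnectedIn G (P '' Set.Icc i j) := by
  refine connectedIn_of_forall_reflTransGen (s := P i) ⟨i, ⟨le_rfl, hij⟩, rfl⟩ ?_
  rintro _ ⟨k, ⟨hik, hkj⟩, rfl⟩
  induction k, hik using Nat.le_induction with
  | base => exact .refl
  | succ k hk ih =>
    exact (ih (by omega)).tail ⟨hP k, ⟨k, ⟨hk, by omega⟩, rfl⟩, ⟨k + 1, ⟨by omega, hkj⟩, rfl⟩⟩

/-- The vertices which can be reached from `s` within `T`. -/
def reachIn (G : SimpleGraph V) (T : Set V) (s : V) : Set V :=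
  {v | Relation.ReflTransGen (fun a b => G.Adj a b ∧ a ∈ T ∧ b ∈ T) s v}

theorem reachIn_subset {T : Set V} {s : V} (hs : s ∈ T) : reachIn G T s ⊆ T := by
  intro v hv
  rcases Relation.ReflTransGen.cases_tail hv with rfl | ⟨_, -, h⟩
  · exact hs
  · exact h.2.2

theorem connectedIn_reachIn (T : Set V) (s : V) : ConnectedIn G (reachIn G T s) := by
  refine connectedIn_of_forall_reflTransGen (s := s) Relation.ReflTransGen.refl ?_
  intro a ha
  induction ha with
  | refl => exact .refl
  | tail h1 h2 ih => exact ih.tail ⟨h2.1, h1, h1.tail h2⟩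

theorem hasMinor_four_of_sets {A₀ A₁ A₂ A₃ : Set V} (h₀ : ConnectedIn G A₀)
    (h₁ : ConnectedIn G A₁) (h₂ : ConnectedIn G A₂) (h₃ : ConnectedIn G A₃)
    (d₀₁ : Disjoint A₀ A₁) (d₀₂ : Disjoint A₀ A₂) (d₀₃ : Disjoint A₀ A₃) (d₁₂ : Disjoint A₁ A₂)
    (d₁₃ : Disjoint A₁ A₃) (d₂₃ : Disjoint A₂ A₃)
    (e₀₁ : ∃ a ∈ A₀, ∃ b ∈ A₁, G.Adj a b) (e₀₂ : ∃ a ∈ A₀, ∃ b ∈ A₂, G.Adj a b)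
    (e₀₃ : ∃ a ∈ A₀, ∃ b ∈ A₃, G.Adj a b) (e₁₂ : ∃ a ∈ A₁, ∃ b ∈ A₂, G.Adj a b)
    (e₁₃ : ∃ a ∈ A₁, ∃ b ∈ A₃, G.Adj a b) (e₂₃ : ∃ a ∈ A₂, ∃ b ∈ A₃, G.Adj a b) :
    HasMinor (completeGraph (Fin 4)) G := by
  have swap : ∀ {A B : Set V}, (∃ a ∈ A, ∃ b ∈ B, G.Adj a b) → ∃ a ∈ B, ∃ b ∈ A, G.Adj a b :=
    fun ⟨a, ha, b, hb, h⟩ => ⟨b, hb, a, ha, h.symm⟩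
  refine ⟨![A₀, A₁, A₂, A₃], ⟨fun i => ?_, fun i j hij => ?_, fun i j hij => ?_⟩⟩
  · fin_cases i <;> assumption
  · fin_cases i <;> fin_cases j <;> first
      | exact absurd rfl hij
      | assumption
      | (apply Disjoint.symm; assumption)
  · fin_cases i <;> fin_cases j <;> first
      | exact absurd rfl hij
      | assumption
      | (apply swap; assumption)

theorem hasMinor_two_three_of_sets {A₀ A₁ B₀ B₁ B₂ : Set V} (h₀ : ConnectedIn G A₀)
    (h₁ : ConnectedIn G A₁) (k₀ : ConnectedIn G B₀) (k₁ : ConnectedIn G B₁)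
    (k₂ : ConnectedIn G B₂) (d : Disjoint A₀ A₁) (d₀₀ : Disjoint A₀ B₀) (d₀₁ : Disjoint A₀ B₁)
    (d₀₂ : Disjoint A₀ B₂) (d₁₀ : Disjoint A₁ B₀) (d₁₁ : Disjoint A₁ B₁) (d₁₂ : Disjoint A₁ B₂)
    (f₀₁ : Disjoint B₀ B₁) (f₀₂ : Disjoint B₀ B₂) (f₁₂ : Disjoint B₁ B₂)
    (e₀₀ : ∃ a ∈ A₀, ∃ b ∈ B₀, G.Adj a b) (e₀₁ : ∃ a ∈ A₀, ∃ b ∈ B₁, G.Adj a b)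
    (e₀₂ : ∃ a ∈ A₀, ∃ b ∈ B₂, G.Adj a b) (e₁₀ : ∃ a ∈ A₁, ∃ b ∈ B₀, G.Adj a b)
    (e₁₁ : ∃ a ∈ A₁, ∃ b ∈ B₁, G.Adj a b) (e₁₂ : ∃ a ∈ A₁, ∃ b ∈ B₂, G.Adj a b) :
    HasMinor (completeBipartiteGraph (Fin 2) (Fin 3)) G := by
  have swap : ∀ {A B : Set V}, (∃ a ∈ A, ∃ b ∈ B, G.Adj a b) → ∃ a ∈ B, ∃ b ∈ A, G.Adj a b :=
    fun ⟨a, ha, b, hb, h⟩ => ⟨b, hb, a, ha, h.symm⟩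
  refine ⟨Sum.elim ![A₀, A₁] ![B₀, B₁, B₂], ⟨fun i => ?_, fun i j hij => ?_, fun i j hij => ?_⟩⟩
  · rcases i with i | i <;> fin_cases i <;> assumption
  · rcases i with i | i <;> rcases j with j | j <;> fin_cases i <;> fin_cases j <;> first
      | exact absurd rfl hij
      | assumption
      | (apply Disjoint.symm; assumption)
  · rcases i with i | i <;> rcases j with j | j
    · simp at hij
    · fin_cases i <;> fin_cases j <;> assumption
    · fin_cases i <;> fin_cases j <;> (apply swap; assumption)
    · simp at hij

/-- The ends of the edge `xy` separate the nonempty set `S` from the other vertices. -/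
structure IsCutOff (G : SimpleGraph V) (x y : V) (S : Set V) : Prop where
  adj : G.Adj x y
  nonempty : S.Nonempty
  left_notMem : x ∉ S
  right_notMem : y ∉ S
  exists_adj : ∀ s ∈ S, ∃ w, G.Adj s w
  mem : ∀ s ∈ S, ∀ w, G.Adj s w → w ∈ S ∨ w = x ∨ w = y

theorem IsCutOff.symm {x y : V} {S : Set V} (h : IsCutOff G x y S) : IsCutOff G y x S :=
  ⟨h.adj.symm, h.nonempty, h.right_notMem, h.left_notMem, h.exists_adj,
    fun s hs w hw => (h.mem s hs w hw).imp id Or.symm⟩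

/-- If only `y` had a neighbor `s` in `S`, the edge `ys` would cut off `S \ {s}`; if neither end had
one, an edge `st` inside `S` would cut off `S \ {s, t}`. These smaller sets are nonempty because
there are no vertices of degree one. -/
theorem IsCutOff.exists_adj_of_minimal {x y : V} {S : Set V} (h : IsCutOff G x y S)
    (hdeg : ∀ v w, G.Adj v w → ∃ w', w' ≠ w ∧ G.Adj v w')
    (hmin : ∀ x' y' S', IsCutOff G x' y' S' → S' ⊆ S → S' = S) : ∃ s ∈ S, G.Adj x s := by
  by_contra! hx
  by_cases hy : ∃ s ∈ S, G.Adj y s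
  · obtain ⟨s, hs, hys⟩ := hy
    obtain ⟨w, hwy, hsw⟩ := hdeg s y hys.symm
    have hwx : w ≠ x := fun e => hx s hs (e ▸ hsw.symm)
    have hw : w ∈ S := (h.mem s hs w hsw).resolve_right (by tauto)
    have := hmin y s (S \ {s}) ⟨hys, ⟨w, hw, hsw.ne'⟩, fun h' => h.right_notMem h'.1,
      fun h' => h'.2 rfl, fun a ha => h.exists_adj a ha.1, fun a ha b hab => ?_⟩ Set.sdiff_subset
    · exact (this.symm ▸ hs : s ∈ S \ {s}).2 rfl
    · rcases h.mem a ha.1 b hab with hb | rfl | rfl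
      · by_cases hbs : b = s
        · tauto
        · exact Or.inl ⟨hb, hbs⟩
      · exact absurd hab.symm (hx a ha.1)
      · tauto
  · push Not at hy
    have hmem : ∀ a ∈ S, ∀ b, G.Adj a b → b ∈ S := fun a ha b hab => by
      rcases h.mem a ha b hab with hb | rfl | rfl
      · exact hb
      · exact absurd hab.symm (hx a ha)
      · exact absurd hab.symm (hy a ha)
    obtain ⟨s, hs⟩ := h.nonempty
    obtain ⟨t, hst⟩ := h.exists_adj s hs
    obtain ⟨w, hwt, hsw⟩ := hdeg s t hst
    have := hmin s t (S \ {s, t}) ⟨hst, ⟨w, hmem s hs w hsw, by simp [hsw.ne', hwt]⟩,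
      by simp, by simp, fun a ha => h.exists_adj a ha.1, fun a ha b hab => ?_⟩ Set.sdiff_subset
    · exact (this.symm ▸ hs : s ∈ S \ {s, t}).2 (Or.inl rfl)
    · by_cases hb : b = s ∨ b = t
      · exact Or.inr hb
      · exact Or.inl ⟨hmem a ha.1 b hab, hb⟩

theorem exists_geodesic {H : SimpleGraph V} {x y : V} (h : H.Reachable x y) :
    ∃ (m : ℕ) (p : ℕ → V), p 0 = x ∧ p m = y ∧ (∀ i < m, H.Adj (p i) (p (i + 1))) ∧
      (∀ i ≤ m, ∀ j ≤ m, H.Adj (p i) (p j) → j ≤ i + 1) ∧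
      ∀ i ≤ m, ∀ j ≤ m, p i = p j → i = j := by
  obtain ⟨W, hW⟩ := h.exists_walk_length_eq_dist
  have hle : ∀ i ≤ W.length, ∀ j ≤ W.length, ∀ w : H.Walk (W.getVert i) (W.getVert j),
      j ≤ i + w.length := by
    intro i hi j hj w
    have := H.dist_le (((W.take i).append w).append (W.drop j))
    simp only [Walk.length_append, Walk.take_length, Walk.drop_length] at this
    omega
  refine ⟨W.length, W.getVert, W.getVert_zero, W.getVert_length,
    fun i hi => W.adj_getVert_succ hi, fun i hi j hj hij => hle i hi j hj hij.toWalk,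
    fun i hi j hj hij => ?_⟩
  have h1 := hle i hi j hj (Walk.nil.copy rfl hij)
  have h2 := hle j hj i hi (Walk.nil.copy rfl hij.symm)
  simp at h1 h2
  omega

/-- A cycle `p 0, …, p m` and a connected set `D` outside the cycle with neighbors in at least two
nonadjacent vertices of the cycle, or in all vertices of a triangle, give a minor. -/
theorem hasMinor_of_cycle {m : ℕ} {p : ℕ → V} {D : Set V} (hm : 2 ≤ m)
    (hinj : ∀ i ≤ m, ∀ j ≤ m, p i = p j → i = j) (hadj : ∀ i < m, G.Adj (p i) (p (i + 1)))
    (hclose : G.Adj (p 0) (p m)) (hD : ConnectedIn G D) (hdisj : ∀ i ≤ m, p i ∉ D)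
    (hJ : ∀ i ≤ m, ∀ j ≤ m, G.Adj (p i) (p j) →
      ∃ k ≤ m, k ≠ i ∧ k ≠ j ∧ ∃ d ∈ D, G.Adj d (p k)) :
    HasMinor (completeGraph (Fin 4)) G ∨
      HasMinor (completeBipartiteGraph (Fin 2) (Fin 3)) G := by
  -- Continuing the cycle periodically turns both arcs between two of its vertices into images of
  -- intervals.
  set P : ℕ → V := fun t => p (t % (m + 1)) with hPdef
  have hPp : ∀ i ≤ m, P i = p i := fun i hi => by simp [hPdef, Nat.mod_eq_of_lt (Nat.lt_succ_of_le hi)]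
  have hPa : ∀ t, G.Adj (P t) (P (t + 1)) := by
    intro t
    have e : (t + 1) % (m + 1) = (t % (m + 1) + 1) % (m + 1) := by simp
    have hlt : t % (m + 1) < m + 1 := Nat.mod_lt t (Nat.succ_pos m)
    simp only [hPdef, e]
    generalize t % (m + 1) = r at hlt
    rcases Nat.lt_or_ge r m with h | h
    · rw [Nat.mod_eq_of_lt (by omega)]
      exact hadj _ h
    · obtain rfl : r = m := by omega
      rw [Nat.mod_self]
      exact hclose.symm
  have hPinj : ∀ a b, a ≤ b → b ≤ a + m → P a = P b → a = b := by
    intro a b hab hba h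
    have h1 := hinj _ (Nat.lt_succ_iff.1 (Nat.mod_lt a (Nat.succ_pos m))) _
      (Nat.lt_succ_iff.1 (Nat.mod_lt b (Nat.succ_pos m))) h
    have h2 : (b - a) % (m + 1) = 0 := Nat.sub_mod_eq_zero_of_mod_eq h1.symm
    rw [Nat.mod_eq_of_lt (by omega)] at h2
    omega
  have hPD : ∀ s : Set ℕ, Disjoint (P '' s) D := fun s => Set.disjoint_left.2 (by
    rintro _ ⟨t, -, rfl⟩
    exact hdisj _ (Nat.lt_succ_iff.1 (Nat.mod_lt t (Nat.succ_pos m))))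
  have hdis : ∀ a b c d, b < c → d ≤ a + m →
      Disjoint (P '' Set.Icc a b) (P '' Set.Icc c d) := by
    intro a b c d hbc hda
    refine Set.disjoint_left.2 ?_
    rintro _ ⟨s, ⟨hs1, hs2⟩, rfl⟩ ⟨t, ⟨ht1, ht2⟩, h⟩
    have := hPinj s t (by omega) (by omega) h.symm
    omega
  have hmem : ∀ a b t, a ≤ t → t ≤ b → P t ∈ P '' Set.Icc a b := fun a b t h1 h2 => ⟨t, ⟨h1, h2⟩, rfl⟩
  let J : ℕ → Prop := fun i => i ≤ m ∧ ∃ d ∈ D, G.Adj d (P i)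
  have hJ' : ∀ i ≤ m, ∀ j ≤ m, G.Adj (p i) (p j) → ∃ k, k ≠ i ∧ k ≠ j ∧ J k := by
    intro i hi j hj hij
    obtain ⟨k, hk, hki, hkj, d, hd, hdk⟩ := hJ i hi j hj hij
    exact ⟨k, hki, hkj, hk, d, hd, by rwa [hPp k hk]⟩
  -- Two attachments of `D` not consecutive on the cycle form one side of `K₂,₃`; the two open arcs
  -- between them and `D` form the other.
  have far : ∀ i j, J i → J j → i + 2 ≤ j → j + 1 ≤ i + m →
      HasMinor (completeBipartiteGraph (Fin 2) (Fin 3)) G := by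
    rintro i j ⟨hi, d, hd, hdi⟩ ⟨hj, e, he, hej⟩ hij hji
    refine hasMinor_two_three_of_sets (A₀ := P '' Set.Icc i i) (A₁ := P '' Set.Icc j j)
      (B₀ := P '' Set.Icc (i + 1) (j - 1)) (B₁ := P '' Set.Icc (j + 1) (i + m)) (B₂ := D)
      (connectedIn_image_Icc hPa (by omega)) (connectedIn_image_Icc hPa (by omega))
      (connectedIn_image_Icc hPa (by omega)) (connectedIn_image_Icc hPa (by omega)) hD
      (hdis _ _ _ _ (by omega) (by omega)) (hdis _ _ _ _ (by omega) (by omega))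
      (hdis _ _ _ _ (by omega) (by omega)) (hPD _)
      (hdis _ _ _ _ (by omega) (by omega)).symm (hdis _ _ _ _ (by omega) (by omega)) (hPD _)
      (hdis _ _ _ _ (by omega) (by omega)) (hPD _) (hPD _)
      ⟨P i, hmem _ _ _ le_rfl le_rfl, P (i + 1), hmem _ _ _ (by omega) (by omega), hPa i⟩
      ⟨P i, hmem _ _ _ le_rfl le_rfl, P (i + m), hmem _ _ _ (by omega) (by omega), ?_⟩
      ⟨P i, hmem _ _ _ le_rfl le_rfl, d, hd, hdi.symm⟩
      ⟨P j, hmem _ _ _ le_rfl le_rfl, P (j - 1), hmem _ _ _ (by omega) (by omega), ?_⟩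
      ⟨P j, hmem _ _ _ le_rfl le_rfl, P (j + 1), hmem _ _ _ (by omega) (by omega), hPa j⟩
      ⟨P j, hmem _ _ _ le_rfl le_rfl, e, he, hej.symm⟩
    · have h1 := hPa (i + m)
      have h2 : P (i + m + 1) = P i := by simp [hPdef, add_assoc]
      exact (h2 ▸ h1).symm
    · have h1 := hPa (j - 1)
      rw [Nat.sub_add_cancel (by omega)] at h1
      exact h1.symm
  -- Avoiding the pairs `{0, m}`, `{i, i + 1}` and `{i - 1, i}` in turn gives attachments `i`, `j`,
  -- `k`. Two of them are nonconsecutive unless `j = i - 1`, `k = i + 1` and `m = 2`; then the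
  -- triangle and `D` form `K₄`.
  obtain ⟨i, hi0, him, hi⟩ := hJ' 0 (by omega) m le_rfl hclose
  have him' : i < m := lt_of_le_of_ne hi.1 him
  obtain ⟨j, hji, hji', hj⟩ := hJ' i hi.1 (i + 1) him' (hadj i him')
  obtain ⟨k, hki', hki, hk⟩ := hJ' (i - 1) (by omega) i hi.1 (by
    have := hadj (i - 1) (by omega)
    rwa [Nat.sub_add_cancel (by omega)] at this)
  have hjm := hj.1
  have hkm := hk.1
  by_cases hj' : j + 1 = i
  · by_cases hk' : k = i + 1
    · by_cases hm2 : m = 2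
      · left
        have hi1 : i = 1 := by omega
        obtain ⟨-, d, hd, hdi⟩ := hi
        obtain ⟨-, e, he, hej⟩ := hj
        obtain ⟨-, f, hf, hfk⟩ := hk
        refine hasMinor_four_of_sets (A₀ := P '' Set.Icc j j) (A₁ := P '' Set.Icc i i)
          (A₂ := P '' Set.Icc k k) (A₃ := D) (connectedIn_image_Icc hPa (by omega))
          (connectedIn_image_Icc hPa (by omega)) (connectedIn_image_Icc hPa (by omega)) hD
          (hdis _ _ _ _ (by omega) (by omega)) (hdis _ _ _ _ (by omega) (by omega)) (hPD _)
          (hdis _ _ _ _ (by omega) (by omega)) (hPD _) (hPD _)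
          ⟨P j, hmem _ _ _ le_rfl le_rfl, P i, hmem _ _ _ le_rfl le_rfl, hj' ▸ hPa j⟩
          ⟨P j, hmem _ _ _ le_rfl le_rfl, P k, hmem _ _ _ le_rfl le_rfl, ?_⟩
          ⟨P j, hmem _ _ _ le_rfl le_rfl, e, he, hej.symm⟩
          ⟨P i, hmem _ _ _ le_rfl le_rfl, P k, hmem _ _ _ le_rfl le_rfl, hk' ▸ hPa i⟩
          ⟨P i, hmem _ _ _ le_rfl le_rfl, d, hd, hdi.symm⟩
          ⟨P k, hmem _ _ _ le_rfl le_rfl, f, hf, hfk.symm⟩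
        rw [hPp j hjm, hPp k hkm]
        have h1 : j = 0 := by omega
        have h2 : k = m := by omega
        rw [h1, h2]
        exact hclose
      · exact Or.inr (far j k hj hk (by omega) (by omega))
    · rcases lt_or_ge k i with h | h
      · exact Or.inr (far k i hk hi (by omega) (by omega))
      · exact Or.inr (far i k hi hk (by omega) (by omega))
  · rcases lt_or_ge j i with h | h
    · exact Or.inr (far j i hj hi (by omega) (by omega))
    · exact Or.inr (far i j hi hj (by omega) (by omega))

/-- In a graph without `K₄` and `K₂,₃` minors and without vertices of degree one there is a cycle
all of whose vertices, except possibly two adjacent ones, have degree two. -/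
theorem exists_end_cycle [Finite V] (h4 : ¬ HasMinor (completeGraph (Fin 4)) G)
    (h23 : ¬ HasMinor (completeBipartiteGraph (Fin 2) (Fin 3)) G)
    (hdeg : ∀ v w, G.Adj v w → ∃ w', w' ≠ w ∧ G.Adj v w') {a b : V} (hab : G.Adj a b) :
    ∃ (m : ℕ) (p : ℕ → V), 2 ≤ m ∧ (∀ i ≤ m, ∀ j ≤ m, p i = p j → i = j) ∧
      (∀ i < m, G.Adj (p i) (p (i + 1))) ∧ G.Adj (p 0) (p m) ∧
      ∀ i, 0 < i → i < m → ∀ w, G.Adj (p i) w → w = p (i - 1) ∨ w = p (i + 1) := by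
  -- A minimal cut-off set exists since `ab` cuts off all other nonisolated vertices.
  obtain ⟨S, ⟨x, y, hS⟩, hmin⟩ : ∃ S : Set V, (∃ x y, IsCutOff G x y S) ∧
      ∀ x' y' S', IsCutOff G x' y' S' → S' ⊆ S → S' = S := by
    obtain ⟨S, hS, hmin⟩ := (wellFounded_lt (α := Set V)).has_min
      {S | ∃ x y, IsCutOff G x y S} ⟨{v | v ≠ a ∧ v ≠ b ∧ ∃ w, G.Adj v w}, a, b, hab, by
        obtain ⟨w, hwb, haw⟩ := hdeg a b hab
        exact ⟨w, haw.ne', hwb, a, haw.symm⟩, fun h => h.1 rfl, fun h => h.2.1 rfl,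
        fun s hs => hs.2.2, fun s hs w hw => by
          by_cases h1 : w = a
          · tauto
          · by_cases h2 : w = b
            · tauto
            · exact Or.inl ⟨h1, h2, s, hw.symm⟩⟩
    refine ⟨S, hS, fun x' y' S' h hsub => ?_⟩
    by_contra hne
    exact hmin S' ⟨x', y', h⟩ (lt_of_le_of_ne hsub hne)
  obtain ⟨s, hs, hxs⟩ := hS.exists_adj_of_minimal hdeg hmin
  obtain ⟨s', hs', hys'⟩ := hS.symm.exists_adj_of_minimal hdeg hmin
  -- Keeping only edges that meet `S` forces the inner vertices of a path from `x` to `y` into `S`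
  -- and forbids the edge `xy` itself.
  let H : SimpleGraph V :=
    { Adj := fun u v => G.Adj u v ∧ (u ∈ S ∨ v ∈ S)
      symm := ⟨fun u v h => ⟨h.1.symm, h.2.symm⟩⟩
      loopless := ⟨fun u h => G.loopless.irrefl u h.1⟩ }
  -- The part of `S` reachable from `x` is again cut off by `xy`, so by minimality it is all of `S`;
  -- hence `y` is reachable too.
  have hreach : {v ∈ S | H.Reachable x v} = S := by
    refine hmin x y _ ⟨hS.adj, ⟨s, hs, Adj.reachable ⟨hxs, Or.inr hs⟩⟩,
      fun h => hS.left_notMem h.1, fun h => hS.right_notMem h.1,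
      fun v hv => hS.exists_adj v hv.1, fun v hv w hvw => ?_⟩ fun v hv => hv.1
    exact (hS.mem v hv.1 w hvw).imp
      (fun hw => ⟨hw, hv.2.trans (Adj.reachable ⟨hvw, Or.inl hv.1⟩)⟩) id
  have hxy : H.Reachable x y := by
    have h1 : s' ∈ {v ∈ S | H.Reachable x v} := hreach.symm ▸ hs'
    exact h1.2.trans (Adj.reachable ⟨hys'.symm, Or.inl hs'⟩)
  obtain ⟨m, p, hp0, hpm, hpadj, hchord, hinj⟩ := exists_geodesic hxy
  have hm : 2 ≤ m := by
    by_contra hlt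
    have : m = 0 ∨ m = 1 := by omega
    rcases this with rfl | rfl
    · exact hS.adj.ne (hp0.symm.trans hpm)
    · have := (hpadj 0 (by omega)).2
      rw [hp0, hpm] at this
      exact this.elim hS.left_notMem hS.right_notMem
  have hpS : ∀ i, 0 < i → i < m → p i ∈ S := by
    intro i hi him
    obtain ⟨h1, h2 | h2⟩ := hpadj i him
    · exact h2
    · refine (hS.mem _ h2 _ h1.symm).resolve_right ?_
      rintro (h | h)
      · have := hinj i him.le 0 (by omega) (h.trans hp0.symm)
        omega
      · have := hinj i him.le m le_rfl (h.trans hpm.symm)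
        omega
  refine ⟨m, p, hm, hinj, fun i hi => (hpadj i hi).1, by rw [hp0, hpm]; exact hS.adj, ?_⟩
  by_cases hall : ∀ v ∈ S, ∃ i ≤ m, v = p i
  · intro i hi him w hw
    obtain ⟨j, hj, rfl⟩ : ∃ j ≤ m, w = p j := by
      rcases hS.mem _ (hpS i hi him) w hw with h | h | h
      · exact hall w h
      · exact ⟨0, by omega, h.trans hp0.symm⟩
      · exact ⟨m, le_rfl, h.trans hpm.symm⟩
    have h1 := hchord i him.le j hj ⟨hw, Or.inl (hpS i hi him)⟩
    have h2 := hchord j hj i him.le ⟨hw.symm, Or.inr (hpS i hi him)⟩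
    have h3 : i ≠ j := fun h => hw.ne (h ▸ rfl)
    rcases (by omega : j = i - 1 ∨ j = i + 1) with rfl | rfl
    · exact Or.inl rfl
    · exact Or.inr rfl
  · exfalso
    push Not at hall
    obtain ⟨v, hv, hvp⟩ := hall
    -- A component of the vertices of `S` off the path, if attached to at most two adjacent vertices
    -- of the cycle, would be a smaller cut-off set missing `p 1`. Otherwise it gives a forbidden
    -- minor.
    set T : Set V := {v ∈ S | ∀ i ≤ m, v ≠ p i} with hT
    have hDT : reachIn G T v ⊆ T := reachIn_subset ⟨hv, hvp⟩
    have hDp : ∀ i ≤ m, p i ∉ reachIn G T v := fun i hi h => (hDT h).2 i hi rfl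
    refine (hasMinor_of_cycle hm hinj (fun i hi => (hpadj i hi).1)
      (by rw [hp0, hpm]; exact hS.adj) (connectedIn_reachIn T v) hDp
      fun i hi j hj hij => ?_).elim h4 h23
    by_contra! hno
    have := hmin (p i) (p j) (reachIn G T v) ⟨hij, ⟨v, Relation.ReflTransGen.refl⟩,
      hDp i hi, hDp j hj, fun s hs => hS.exists_adj s (hDT hs).1, fun d hd w hdw => ?_⟩
      fun d hd => (hDT hd).1
    · exact hDp 1 (by omega) (this.symm ▸ hpS 1 one_pos (by omega))
    · by_cases hw : ∃ k ≤ m, w = p k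
      · obtain ⟨k, hk, rfl⟩ := hw
        by_cases hki : k = i
        · exact Or.inr (Or.inl (hki ▸ rfl))
        · by_cases hkj : k = j
          · exact Or.inr (Or.inr (hkj ▸ rfl))
          · exact absurd hdw (hno k hk hki hkj d hd)
      · push Not at hw
        left
        refine Relation.ReflTransGen.tail hd ⟨hdw, hDT hd, ?_, hw⟩
        rcases hS.mem d (hDT hd).1 w hdw with h | h | h
        · exact h
        · exact absurd (h.trans hp0.symm) (hw 0 (by omega))
        · exact absurd (h.trans hpm.symm) (hw m le_rfl)

end Structure

/-! ### Extending a coloring along a path -/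

section Coloring

variable {V : Type*} {G H : SimpleGraph V}

/-- The vertices `u, v, w, x` form, in this order, a simple path of length three. -/
structure IsSimpleThreePath (G : SimpleGraph V) (u v w x : V) : Prop where
  consecutive : Consecutive G u v w x
  ne : u ≠ x
  left : ∀ z, G.Adj v z → z = u ∨ z = w
  right : ∀ z, G.Adj w z → z = v ∨ z = x

/-- `c` is an injective edge-coloring and every simple path of length three whose middle edge is
not in `Z` receives two colors. -/
structure IsGoodColoring (G : SimpleGraph V) (Z : Set (Sym2 V)) (c : Sym2 V → Fin 5) : Prop where
  ne : ∀ u v w x, Consecutive G u v w x → c s(u, v) ≠ c s(w, x)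
  eq_or_eq : ∀ u v w x, IsSimpleThreePath G u v w x → s(v, w) ∉ Z →
    c s(v, w) = c s(u, v) ∨ c s(v, w) = c s(w, x)

/-- `p 0, …, p m` is a path whose inner vertices have degree zero in the subgraph `H` of `G`, whose
ends are adjacent in `H`, and whose edges together with `H` form `G`. -/
structure IsEar (G H : SimpleGraph V) (m : ℕ) (p : ℕ → V) : Prop where
  two_le : 2 ≤ m
  inj : ∀ i ≤ m, ∀ j ≤ m, p i = p j → i = j
  le : H ≤ G
  adj : ∀ i < m, G.Adj (p i) (p (i + 1))
  close : H.Adj (p 0) (p m)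
  inner : ∀ i, 0 < i → i < m → ∀ w, ¬ H.Adj (p i) w
  cover : ∀ u v, G.Adj u v → H.Adj u v ∨ ∃ i < m, s(u, v) = s(p i, p (i + 1))

namespace IsEar

variable {m : ℕ} {p : ℕ → V}

theorem not_adj (h : IsEar G H m p) {i : ℕ} (hi : i < m) : ¬ H.Adj (p i) (p (i + 1)) := by
  intro h'
  have := h.two_le
  rcases Nat.eq_zero_or_pos i with rfl | h0
  · exact h.inner 1 (by omega) (by omega) _ h'.symm
  · exact h.inner i h0 hi _ h'

theorem adj_inner (h : IsEar G H m p) {i : ℕ} (h0 : 0 < i) (hi : i < m) {w : V}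
    (hw : G.Adj (p i) w) : w = p (i - 1) ∨ w = p (i + 1) := by
  obtain hw | ⟨j, hj, e⟩ := h.cover _ _ hw
  · exact absurd hw (h.inner i h0 hi w)
  · rcases Sym2.eq_iff.1 e with ⟨e1, e2⟩ | ⟨e1, e2⟩
    · obtain rfl := h.inj i hi.le j hj.le e1
      exact Or.inr e2
    · obtain rfl := h.inj i hi.le (j + 1) hj e1
      exact Or.inl e2

theorem adj_zero (h : IsEar G H m p) {w : V} (hw : G.Adj (p 0) w) :
    H.Adj (p 0) w ∨ w = p 1 := by
  refine (h.cover _ _ hw).imp_right ?_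
  rintro ⟨j, hj, e⟩
  rcases Sym2.eq_iff.1 e with ⟨e1, e2⟩ | ⟨e1, e2⟩
  · obtain rfl := h.inj 0 (by omega) j hj.le e1
    exact e2
  · have := h.inj 0 (by omega) (j + 1) hj e1
    omega

theorem adj_last (h : IsEar G H m p) {w : V} (hw : G.Adj (p m) w) :
    H.Adj (p m) w ∨ w = p (m - 1) := by
  refine (h.cover _ _ hw).imp_right ?_
  rintro ⟨j, hj, e⟩
  rcases Sym2.eq_iff.1 e with ⟨e1, e2⟩ | ⟨e1, e2⟩
  · have := h.inj m le_rfl j hj.le e1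
    omega
  · obtain rfl := h.inj m le_rfl (j + 1) hj e1
    exact e2

theorem adj_of_adj (h : IsEar G H m p) {u v w : V} (hvw : H.Adj v w) (huv : G.Adj v u) :
    H.Adj v u ∨ (v = p 0 ∧ u = p 1) ∨ (v = p m ∧ u = p (m - 1)) := by
  obtain hw | ⟨j, hj, e⟩ := h.cover _ _ huv
  · exact Or.inl hw
  · right
    rcases Sym2.eq_iff.1 e with ⟨rfl, rfl⟩ | ⟨rfl, rfl⟩
    · rcases Nat.eq_zero_or_pos j with rfl | h0
      · exact Or.inl ⟨rfl, rfl⟩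
      · exact absurd hvw (h.inner j h0 hj _)
    · rcases Nat.lt_or_ge (j + 1) m with h0 | h0
      · exact absurd hvw (h.inner (j + 1) (by omega) h0 _)
      · obtain rfl : m = j + 1 := by omega
        exact Or.inr ⟨rfl, rfl⟩

theorem ne_zero_last (h : IsEar G H m p) : p 0 ≠ p m := h.close.ne

theorem exists_recoloring (h : IsEar G H m p) (c : Sym2 V → Fin 5) (f : ℕ → Fin 5) :
    ∃ c' : Sym2 V → Fin 5, (∀ i < m, c' s(p i, p (i + 1)) = f i) ∧
      ∀ u v, H.Adj u v → c' s(u, v) = c s(u, v) := by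
  classical
  refine ⟨fun e => if he : ∃ i < m, e = s(p i, p (i + 1)) then f he.choose else c e,
    fun i hi => ?_, fun u v huv => ?_⟩
  · have he : ∃ j < m, s(p i, p (i + 1)) = s(p j, p (j + 1)) := ⟨i, hi, rfl⟩
    simp only [dif_pos he]
    have h1 := he.choose_spec.1
    rcases Sym2.eq_iff.1 he.choose_spec.2 with ⟨e1, -⟩ | ⟨e1, e2⟩
    · rw [← h.inj i hi.le _ h1.le e1]
    · have := h.inj i hi.le _ h1 e1
      have := h.inj (i + 1) hi _ h1.le e2
      omega
  · refine dif_neg ?_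
    rintro ⟨i, hi, e⟩
    rcases Sym2.eq_iff.1 e with ⟨rfl, rfl⟩ | ⟨rfl, rfl⟩
    · exact h.not_adj hi huv
    · exact h.not_adj hi huv.symm

/-- Conditions under which a coloring of `H` and colors for the edges of an ear
form a good coloring. -/
theorem exists_isGoodColoring (h : IsEar G H m p) {Z Z' : Set (Sym2 V)} {c : Sym2 V → Fin 5}
    (hc : IsGoodColoring H Z' c)
    (hZ : ∀ v w, v ≠ p 0 → v ≠ p m → w ≠ p 0 → w ≠ p m → s(v, w) ∈ Z' → s(v, w) ∈ Z) (f : ℕ → Fin 5)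
    (hA : ∀ w z, H.Adj (p 0) w → w ≠ p m → H.Adj w z → z ≠ p 0 → f 0 ≠ c s(w, z))
    (hSb : ∀ z, H.Adj (p m) z → z ≠ p 0 → f 0 ≠ c s(p m, z))
    (hB : ∀ w z, H.Adj (p m) w → w ≠ p 0 → H.Adj w z → z ≠ p m → f (m - 1) ≠ c s(w, z))
    (hSa : ∀ z, H.Adj (p 0) z → z ≠ p m → f (m - 1) ≠ c s(p 0, z))
    (hSa1 : ∀ z, H.Adj (p 0) z → f 1 ≠ c s(p 0, z))
    (hSb1 : ∀ z, H.Adj (p m) z → f (m - 2) ≠ c s(p m, z))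
    (h0 : f 0 ≠ f (m - 1)) (hf : ∀ i, i + 2 < m → f i ≠ f (i + 2))
    (hf' : ∀ i, i + 2 < m → f (i + 1) = f i ∨ f (i + 1) = f (i + 2))
    (hx : (∀ z, H.Adj (p 0) z → z = p m) → s(p 0, p 1) ∉ Z →
      m = 2 ∨ f 0 = c s(p 0, p m) ∨ f 0 = f 1)
    (hy : (∀ z, H.Adj (p m) z → z = p 0) → s(p (m - 1), p m) ∉ Z →
      m = 2 ∨ f (m - 1) = c s(p 0, p m) ∨ f (m - 1) = f (m - 2))
    (hxy : (∀ z, H.Adj (p 0) z → z = p m) → (∀ z, H.Adj (p m) z → z = p 0) →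
      s(p 0, p m) ∉ Z → m = 2 ∨ f 0 = c s(p 0, p m) ∨ f (m - 1) = c s(p 0, p m)) :
    ∃ c', IsGoodColoring G Z c' := by
  obtain ⟨c', hc'f, hc'c⟩ := h.exists_recoloring c f
  have hm := h.two_le
  have sw : ∀ u v, c' s(u, v) = c' s(v, u) := fun u v => by rw [Sym2.eq_swap]
  have swc : ∀ u v, c s(u, v) = c s(v, u) := fun u v => by rw [Sym2.eq_swap]
  have hc'f' : ∀ i < m, c' s(p (i + 1), p i) = f i := fun i hi => by rw [sw, hc'f i hi]
  have hlast : c' s(p (m - 1), p m) = f (m - 1) := by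
    have := hc'f (m - 1) (by omega)
    rwa [Nat.sub_add_cancel (by omega)] at this
  have hfirst : c' s(p 0, p 1) = f 0 := hc'f 0 (by omega)
  have key1 : ∀ u v w x, (∃ i < m, v = p i ∧ w = p (i + 1)) → Consecutive G u v w x →
      c' s(u, v) ≠ c' s(w, x) := by
    rintro u _ _ x ⟨i, hi, rfl, rfl⟩ ⟨huv, -, hwx, huw, hvx⟩
    rcases Nat.eq_zero_or_pos i with rfl | hi0
    · obtain rfl : x = p 2 := (h.adj_inner one_pos (by omega) hwx).resolve_left hvx.symm
      have hu := (h.adj_zero huv.symm).resolve_right huw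
      rw [hc'f 1 (by omega), sw, hc'c _ _ hu]
      exact (hSa1 u hu).symm
    · obtain rfl : u = p (i - 1) := (h.adj_inner hi0 hi huv.symm).resolve_right huw
      have e1 := hc'f (i - 1) (by omega)
      rw [Nat.sub_add_cancel (by omega)] at e1
      rcases Nat.lt_or_ge (i + 1) m with him | him
      · obtain rfl : x = p (i + 1 + 1) :=
          (h.adj_inner (by omega) him hwx).resolve_left hvx.symm
        rw [e1, hc'f _ him]
        have := hf (i - 1) (by omega)
        rwa [show i - 1 + 2 = i + 1 by omega] at this
      · obtain rfl : m = i + 1 := by omega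
        have hx := (h.adj_last hwx).resolve_right hvx.symm
        rw [e1, hc'c _ _ hx]
        exact hSb1 x hx
  have key2 : ∀ u v w x, H.Adj v w → Consecutive G u v w x → c' s(u, v) ≠ c' s(w, x) := by
    rintro u v w x hvwH ⟨huv, hvw, hwx, huw, hvx⟩
    rcases h.adj_of_adj hvwH huv.symm with hu | ⟨rfl, rfl⟩ | ⟨rfl, rfl⟩ <;>
    rcases h.adj_of_adj hvwH.symm hwx with hx | ⟨rfl, rfl⟩ | ⟨rfl, rfl⟩
    · rw [hc'c _ _ hu.symm, hc'c _ _ hx]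
      exact hc.ne u v w x ⟨hu.symm, hvwH, hx, huw, hvx⟩
    · rw [hc'c _ _ hu.symm, hfirst]
      by_cases hv : v = p m
      · subst hv
        rw [swc]
        exact (hSb u hu huw).symm
      · rw [swc]
        exact (hA v u hvwH.symm hv hu huw).symm
    · rw [hc'c _ _ hu.symm, sw (p m), hlast]
      by_cases hv : v = p 0
      · subst hv
        rw [swc]
        exact (hSa u hu huw).symm
      · rw [swc]
        exact (hB v u hvwH.symm hv hu huw).symm
    · rw [hc'c _ _ hx, sw, hfirst]
      by_cases hw : w = p m
      · subst hw
        exact hSb x hx hvx.symm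
      · exact hA w x hvwH hw hx hvx.symm
    · exact absurd rfl hvwH.ne
    · rw [sw, hfirst, sw (p m), hlast]
      exact h0
    · rw [hc'c _ _ hx, hlast]
      by_cases hw : w = p 0
      · subst hw
        exact hSa x hx hvx.symm
      · exact hB w x hvwH hw hx hvx.symm
    · rw [hlast, hfirst]
      exact h0.symm
    · exact absurd rfl hvwH.ne
  have two1 : ∀ u v w x, (∃ i < m, v = p i ∧ w = p (i + 1)) → IsSimpleThreePath G u v w x →
      s(v, w) ∉ Z → c' s(v, w) = c' s(u, v) ∨ c' s(v, w) = c' s(w, x) := by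
    rintro u _ _ x ⟨i, hi, rfl, rfl⟩ ⟨⟨huv, -, hwx, huw, hvx⟩, hux, hl, hr⟩ hZvw
    rw [hc'f i hi]
    rcases Nat.eq_zero_or_pos i with rfl | hi0
    · obtain rfl : x = p 2 := (h.adj_inner one_pos (by omega) hwx).resolve_left hvx.symm
      have hne : p m ≠ p 1 := fun e => by
        have := h.inj m le_rfl 1 (by omega) e
        omega
      obtain rfl : p m = u := (hl _ (h.le h.close)).resolve_right hne
      rw [hc'f 1 (by omega), sw, hc'c _ _ h.close]
      refine (hx (fun z hz => (hl z (h.le hz)).resolve_right ?_) hZvw).resolve_left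
        fun e => hux (e ▸ rfl)
      rintro rfl
      exact h.inner 1 one_pos (by omega) _ hz.symm
    · obtain rfl : u = p (i - 1) := (h.adj_inner hi0 hi huv.symm).resolve_right huw
      have e1 := hc'f (i - 1) (by omega)
      rw [Nat.sub_add_cancel (by omega)] at e1
      rcases Nat.lt_or_ge (i + 1) m with him | him
      · obtain rfl : x = p (i + 1 + 1) :=
          (h.adj_inner (by omega) him hwx).resolve_left hvx.symm
        rw [e1, hc'f _ him]
        have := hf' (i - 1) (by omega)
        rwa [show i - 1 + 2 = i + 1 by omega, Nat.sub_add_cancel (by omega)] at this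
      · obtain rfl : m = i + 1 := by omega
        have hne : p 0 ≠ p i := fun e => by
          have := h.inj 0 (by omega) i hi.le e
          omega
        obtain rfl : p 0 = x := (hr _ (h.le h.close).symm).resolve_left hne
        rw [e1, sw _ (p 0), hc'c _ _ h.close]
        have := (hy (fun z hz => (hr z (h.le hz)).resolve_left ?_) hZvw).resolve_left
          fun e => hux (by rw [show i - 1 = 0 by omega])
        · simpa [or_comm] using this
        · rintro rfl
          exact h.inner i hi0 hi _ hz.symm
  have two2 : ∀ u v w x, H.Adj v w → IsSimpleThreePath G u v w x →
      s(v, w) ∉ Z → c' s(v, w) = c' s(u, v) ∨ c' s(v, w) = c' s(w, x) := by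
    have ends : ∀ u x, IsSimpleThreePath G u (p 0) (p m) x → s(p 0, p m) ∉ Z →
        c' s(p 0, p m) = c' s(u, p 0) ∨ c' s(p 0, p m) = c' s(p m, x) := by
      rintro u x ⟨-, hux, hl, hr⟩ hZvw
      have h1 : ∀ {i}, i ≤ m → ∀ {j}, j ≤ m → i ≠ j → p i ≠ p j := fun hi _ hj hij e =>
        hij (h.inj _ hi _ hj e)
      have a1 := h.adj 0 (by omega)
      have a2 := h.adj (m - 1) (by omega)
      rw [Nat.sub_add_cancel (by omega)] at a2
      obtain rfl : p 1 = u := (hl _ a1).resolve_right (h1 (by omega) le_rfl (by omega))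
      obtain rfl : p (m - 1) = x := (hr _ a2.symm).resolve_left (h1 (by omega) (by omega) (by omega))
      rw [sw (p 1), hfirst, sw (p m), hlast, hc'c _ _ h.close]
      have := hxy (fun z hz => (hl z (h.le hz)).resolve_left ?_)
        (fun z hz => (hr z (h.le hz)).resolve_right ?_) hZvw
      · rcases this with e | e | e
        · subst e
          exact absurd rfl hux
        · exact Or.inl e.symm
        · exact Or.inr e.symm
      · rintro rfl
        exact h.inner 1 one_pos (by omega) _ hz.symm
      · rintro rfl
        exact h.inner (m - 1) (by omega) (by omega) _ hz.symm
    -- If `p 0` is an inner vertex of a simple path, its only neighbors are `p 1` and `p m`. So `p 0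
    -- p m` is the only edge of `H` at `p 0` that needs checking as a middle edge.
    have zero : ∀ u v w x, H.Adj v w → IsSimpleThreePath G u v w x → v = p 0 → w = p m := by
      rintro u _ w x hvw hs rfl
      have a1 := h.adj 0 (by omega)
      have hw1 : w ≠ p 1 := fun e => h.inner 1 one_pos (by omega) _ (e ▸ hvw.symm)
      have hu := (hs.left _ a1).resolve_right hw1.symm
      refine ((hs.left _ (h.le h.close)).resolve_left fun e => ?_).symm
      have := h.inj m le_rfl 1 (by omega) (e.trans hu.symm)
      omega
    have last : ∀ u v w x, H.Adj v w → IsSimpleThreePath G u v w x → v = p m → w = p 0 := by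
      rintro u _ w x hvw hs rfl
      have a1 := h.adj (m - 1) (by omega)
      rw [Nat.sub_add_cancel (by omega)] at a1
      have hw1 : w ≠ p (m - 1) := fun e =>
        h.inner (m - 1) (by omega) (by omega) _ (e ▸ hvw.symm)
      have hu := (hs.left _ a1.symm).resolve_right hw1.symm
      refine ((hs.left _ (h.le h.close.symm)).resolve_left fun e => ?_).symm
      have := h.inj 0 (by omega) (m - 1) (by omega) (e.trans hu.symm)
      omega
    have rev : ∀ {u v w x}, IsSimpleThreePath G u v w x → IsSimpleThreePath G x w v u :=
      fun hs => ⟨⟨hs.1.2.2.1.symm, hs.1.2.1.symm, hs.1.1.symm, hs.1.2.2.2.2.symm,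
        hs.1.2.2.2.1.symm⟩, hs.ne.symm, fun z hz => (hs.right z hz).symm,
        fun z hz => (hs.left z hz).symm⟩
    intro u v w x hvw hs hZvw
    have flip : v = p m → w = p 0 →
        c' s(v, w) = c' s(u, v) ∨ c' s(v, w) = c' s(w, x) := by
      rintro rfl rfl
      rw [sw (p m) (p 0), sw u, sw (p 0) x]
      rw [Sym2.eq_swap] at hZvw
      exact (ends x u (rev hs) hZvw).symm
    by_cases hv0 : v = p 0
    · obtain rfl := zero u v w x hvw hs hv0
      subst hv0
      exact ends u x hs hZvw
    by_cases hvm : v = p m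
    · exact flip hvm (last u v w x hvw hs hvm)
    by_cases hw0 : w = p 0
    · exact flip (zero x w v u hvw.symm (rev hs) hw0) hw0
    by_cases hwm : w = p m
    · exact absurd (last x w v u hvw.symm (rev hs) hwm) hv0
    have hu : H.Adj v u := (h.adj_of_adj hvw hs.1.1.symm).resolve_right (by tauto)
    have hx : H.Adj w x := (h.adj_of_adj hvw.symm hs.1.2.2.1).resolve_right (by tauto)
    rw [hc'c _ _ hvw, hc'c _ _ hu.symm, hc'c _ _ hx]
    exact hc.eq_or_eq u v w x ⟨⟨hu.symm, hvw, hx, hs.1.2.2.2⟩, hs.ne,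
      fun z hz => hs.left z (h.le hz), fun z hz => hs.right z (h.le hz)⟩
      fun hmem => hZvw (hZ v w hv0 hvm hw0 hwm hmem)
  refine ⟨c', fun u v w x hcons => ?_, fun u v w x hs hZvw => ?_⟩
  · obtain hvw | ⟨i, hi, e⟩ := h.cover v w hcons.2.1
    · exact key2 u v w x hvw hcons
    · rcases Sym2.eq_iff.1 e with ⟨e1, e2⟩ | ⟨e1, e2⟩
      · exact key1 u v w x ⟨i, hi, e1, e2⟩ hcons
      · rw [sw u, sw w]
        exact (key1 x w v u ⟨i, hi, e2, e1⟩ ⟨hcons.2.2.1.symm, hcons.2.1.symm, hcons.1.symm,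
          hcons.2.2.2.2.symm, hcons.2.2.2.1.symm⟩).symm
  · obtain hvw | ⟨i, hi, e⟩ := h.cover v w hs.1.2.1
    · exact two2 u v w x hvw hs hZvw
    · rcases Sym2.eq_iff.1 e with ⟨e1, e2⟩ | ⟨e1, e2⟩
      · exact two1 u v w x ⟨i, hi, e1, e2⟩ hs hZvw
      · rw [sw u, sw w, sw v]
        rw [Sym2.eq_swap] at hZvw
        exact (two1 x w v u ⟨i, hi, e2, e1⟩ ⟨⟨hs.1.2.2.1.symm, hs.1.2.1.symm, hs.1.1.symm,
          hs.1.2.2.2.2.symm, hs.1.2.2.2.1.symm⟩, hs.ne.symm, fun z hz => (hs.right z hz).symm,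
          fun z hz => (hs.left z hz).symm⟩ hZvw).symm

end IsEar

/-! ### Choosing five colors along an ear -/

theorem exists_notMem_of_card_le_four {F : Finset (Fin 5)} (h : F.card ≤ 4) : ∃ x, x ∉ F := by
  by_contra! hF
  have : F = Finset.univ := Finset.eq_univ_iff_forall.2 hF
  subst this
  simp at h

/-- Built backwards from `ω`: the preceding color is taken outside `F ∪ {ω}`, which has at most four
elements. It differs from `α` because `α ∈ F`, so the induction continues. -/
theorem exists_color_walk {F : Finset (Fin 5)} (hF : F.card ≤ 3) {α : Fin 5} (hα : α ∈ F) {k : ℕ}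
    (hk : 1 ≤ k) : ∀ {ω : Fin 5}, ω ≠ α →
      ∃ q : ℕ → Fin 5, q 0 = α ∧ q k = ω ∧ (∀ i < k, q i ≠ q (i + 1)) ∧
        ∀ i, 0 < i → i < k → q i ∉ F := by
  induction k, hk using Nat.le_induction with
  | base =>
    intro ω hω
    exact ⟨fun i => if i = 0 then α else ω, rfl, rfl, fun i hi => by
      obtain rfl : i = 0 := by omega
      exact hω.symm, fun i h0 h1 => by omega⟩
  | succ k hk ih =>
    intro ω hω
    obtain ⟨β, hβ⟩ := exists_notMem_of_card_le_four (F := insert ω F)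
      ((Finset.card_insert_le _ _).trans (by omega))
    rw [Finset.mem_insert, not_or] at hβ
    obtain ⟨q, h0, hqk, hne, hin⟩ := ih (ω := β) fun h => hβ.2 (h ▸ hα)
    refine ⟨fun i => if i = k + 1 then ω else q i, by simp [h0], by simp, fun i hi => ?_,
      fun i hi hik => ?_⟩
    · dsimp only
      rw [if_neg (by omega)]
      split_ifs with h
      · obtain rfl : i = k := by omega
        rw [hqk]
        exact hβ.1
      · exact hne i (by omega)
    · dsimp only
      rw [if_neg (by omega)]
      rcases Nat.lt_or_ge i k with h | h
      · exact hin i hi h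
      · obtain rfl : i = k := by omega
        rw [hqk]
        exact hβ.2

/-- The color `q ((i + s) / 2)` on the `i`-th edge makes consecutive edges agree in pairs; the shift
`s = 1` leaves the first edge alone. Edges two apart carry successive, hence different, colors of
`q`. -/
theorem two_colors_of_pairing {q : ℕ → Fin 5} {k s m : ℕ} (hk : m + s ≤ 2 * k + 2)
    (hq : ∀ i < k, q i ≠ q (i + 1)) :
    (∀ i, i + 2 < m → q ((i + s) / 2) ≠ q ((i + 2 + s) / 2)) ∧
      ∀ i, i + 2 < m → q ((i + 1 + s) / 2) = q ((i + s) / 2) ∨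
        q ((i + 1 + s) / 2) = q ((i + 2 + s) / 2) := by
  refine ⟨fun i hi => ?_, fun i hi => ?_⟩
  · have := hq ((i + s) / 2) (by omega)
    rwa [show (i + 2 + s) / 2 = (i + s) / 2 + 1 by omega]
  · rcases (by omega : (i + 1 + s) / 2 = (i + s) / 2 ∨ (i + 1 + s) / 2 = (i + 2 + s) / 2)
      with h | h
    · exact Or.inl (by rw [h])
    · exact Or.inr (by rw [h])

/-- Colors for the edges of an ear with end edge colored `t`, when the colors near and far from the
first end form the sets `Sa` and `A`, and those near and far from the last end `Sb` and `B`. -/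
theorem exists_ear_colors (A Sa B Sb : Finset (Fin 5)) (t : Fin 5) {m : ℕ} (hm : 2 ≤ m)
    (hSa : Sa.card ≤ 1) (hSb : Sb.card ≤ 1) (h4 : (A ∪ Sa ∪ Sb ∪ {t}).card ≤ 4)
    (h3 : (B ∪ Sa ∪ {t}).card ≤ 3) (htA : t ∉ A) (htSb : t ∈ Sb → Sa = ∅ ∧ A = ∅) :
    ∃ f : ℕ → Fin 5, (f 0 ∉ A ∧ f 0 ∉ Sb) ∧ (f (m - 1) ∉ B ∧ f (m - 1) ∉ Sa) ∧
      (f 1 ∉ Sa ∧ f 1 ≠ t) ∧ (f (m - 2) ∉ Sb ∧ f (m - 2) ≠ t) ∧ f 0 ≠ f (m - 1) ∧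
      (∀ i, i + 2 < m → f i ≠ f (i + 2)) ∧
      (∀ i, i + 2 < m → f (i + 1) = f i ∨ f (i + 1) = f (i + 2)) ∧
      (m = 2 ∨ f 0 = t ∨ f 0 = f 1) ∧
      (B ∪ Sa = ∅ → m = 2 ∨ Even m ∨ f (m - 1) = t) ∧
      (B ∪ Sa ∪ Sb = ∅ → m = 2 ∨ f 0 = t ∨ f (m - 1) = t) := by
  have hlast : ∀ q, q ≠ t → ∃ ω, ω ≠ q ∧ ω ∉ B ∧ ω ∉ Sa ∧ (B ∪ Sa = ∅ → ω = t) := by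
    intro q hq
    by_cases hBS : B ∪ Sa = ∅
    · obtain ⟨rfl, rfl⟩ := Finset.union_eq_empty.1 hBS
      exact ⟨t, hq.symm, by simp, by simp, fun _ => rfl⟩
    · obtain ⟨ω, hω⟩ := exists_notMem_of_card_le_four (F := insert q (B ∪ Sa ∪ {t}))
        ((Finset.card_insert_le _ _).trans (by omega))
      simp only [Finset.mem_insert, Finset.mem_union, Finset.mem_singleton, not_or] at hω
      exact ⟨ω, hω.1, hω.2.1.1, hω.2.1.2, fun h => absurd h hBS⟩
  obtain ⟨k, rfl | rfl⟩ := Nat.even_or_odd' m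
  · rcases Nat.lt_or_ge k 2 with hk | hk
    · obtain rfl : k = 1 := by omega
      obtain ⟨α, hα⟩ := exists_notMem_of_card_le_four h4
      obtain ⟨ω, hω⟩ := exists_notMem_of_card_le_four (F := insert α (B ∪ Sa ∪ {t}))
        ((Finset.card_insert_le _ _).trans (by omega))
      simp only [Finset.mem_insert, Finset.mem_union, Finset.mem_singleton, not_or] at hα hω
      refine ⟨fun i => if i = 0 then α else ω, ?_⟩
      simp only [mul_one, Nat.add_one_sub_one, Nat.sub_self, if_true, one_ne_zero, if_false]
      exact ⟨⟨hα.1.1.1, hα.1.2⟩, hω.2.1, ⟨hω.2.1.2, hω.2.2⟩, ⟨hα.1.2, hα.2⟩, Ne.symm hω.1,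
        fun i hi => by omega, fun i hi => by omega, Or.inl trivial, fun _ => Or.inl trivial,
        fun _ => Or.inl trivial⟩
    -- If `t` occurs near the last end, it is forbidden on the first edge, so all edges are paired
    -- from the start. The color `ω` of the last pair avoids `Sb = {t}` automatically.
    by_cases ht : t ∈ Sb
    · obtain ⟨rfl, rfl⟩ := htSb ht
      have hSb' : Sb = {t} := by
        obtain ⟨x, rfl⟩ := Finset.card_eq_one.1 (le_antisymm hSb (Finset.card_pos.2 ⟨t, ht⟩))
        rw [Finset.mem_singleton.1 ht]
      obtain ⟨α, hα⟩ := exists_notMem_of_card_le_four h4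
      obtain ⟨ω, hω⟩ := exists_notMem_of_card_le_four (F := insert α (B ∪ ∅ ∪ {t}))
        ((Finset.card_insert_le _ _).trans (by omega))
      subst hSb'
      simp only [Finset.mem_insert, Finset.mem_union, Finset.mem_singleton, not_or] at hα hω
      obtain ⟨q, q0, qk, hne, hin⟩ := exists_color_walk (F := {t, α})
        (Finset.card_le_two.trans (by omega)) (α := α) (by simp) (k := k - 1) (by omega) hω.1
      obtain ⟨hf, hf'⟩ := two_colors_of_pairing (s := 0) (m := 2 * k) (by omega) hne
      refine ⟨fun i => q (i / 2), ?_⟩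
      have e1 : (2 * k - 1) / 2 = k - 1 := by omega
      have e2 : (2 * k - 2) / 2 = k - 1 := by omega
      simp only [e1, e2, qk, Nat.zero_div, q0, Nat.reduceDiv]
      refine ⟨⟨by simp, by simpa using hα.2⟩, ⟨hω.2.1.1, by simp⟩, ⟨by simp, hα.2⟩,
        ⟨by simpa using hω.2.2, hω.2.2⟩, Ne.symm hω.1, hf, hf', Or.inr (Or.inr trivial),
        fun _ => Or.inr (Or.inl (by simp)), fun h => ?_⟩
      simp at h
    · obtain ⟨ω, hω⟩ := exists_notMem_of_card_le_four (F := B ∪ Sa ∪ {t}) (by omega)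
      simp only [Finset.mem_union, Finset.mem_singleton, not_or] at hω
      have hF : (Sa ∪ Sb ∪ {t}).card ≤ 3 := by
        have h1 := Finset.card_union_le (Sa ∪ Sb) {t}
        have h2 := Finset.card_union_le Sa Sb
        rw [Finset.card_singleton] at h1
        omega
      -- With `s = 1` the first edge alone gets `t` and the last edge alone gets `ω`. On an isolated
      -- odd cycle the last edge then agrees with neither neighbor: this is the alternative `Even m`
      -- in the conclusion.
      obtain ⟨q, q0, qk, hne, hin⟩ := exists_color_walk hF (α := t) (by simp) (k := k)
        (by omega) hω.2
      obtain ⟨hf, hf'⟩ := two_colors_of_pairing (s := 1) (m := 2 * k) (by omega) hne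
      refine ⟨fun i => q ((i + 1) / 2), ?_⟩
      have e1 : (2 * k - 1 + 1) / 2 = k := by omega
      have e2 : (2 * k - 2 + 1) / 2 = k - 1 := by omega
      have h1 := hin 1 (by omega) (by omega)
      have h2 := hin (k - 1) (by omega) (by omega)
      simp only [Finset.mem_union, Finset.mem_singleton, not_or] at h1 h2
      simp only [e1, e2, qk, zero_add, Nat.reduceDiv, q0, Nat.reduceAdd]
      exact ⟨⟨htA, ht⟩, hω.1, ⟨h1.1.1, h1.2⟩, ⟨h2.1.2, h2.2⟩, Ne.symm hω.2, hf, hf',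
        Or.inr (Or.inl trivial), fun _ => Or.inr (Or.inl (by simp)),
        fun _ => Or.inr (Or.inl trivial)⟩
  · obtain ⟨α, hα⟩ := exists_notMem_of_card_le_four h4
    simp only [Finset.mem_union, Finset.mem_singleton, not_or] at hα
    obtain ⟨ω, hω, hωB, hωSa, hωt⟩ := hlast α hα.2
    have hF : (Sb ∪ {t, α}).card ≤ 3 := by
      have h1 := Finset.card_union_le Sb {t, α}
      have h2 : ({t, α} : Finset (Fin 5)).card ≤ 2 := Finset.card_le_two
      omega
    obtain ⟨q, q0, qk, hne, hin⟩ := exists_color_walk hF (α := α) (by simp) (k := k)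
      (by omega) hω
    obtain ⟨hf, hf'⟩ := two_colors_of_pairing (s := 0) (m := 2 * k + 1) (by omega) hne
    refine ⟨fun i => q (i / 2), ?_⟩
    have e1 : (2 * k + 1 - 1) / 2 = k := by omega
    have e2 : (2 * k + 1 - 2) / 2 = k - 1 := by omega
    have h2 : q (k - 1) ∉ Sb ∧ q (k - 1) ≠ t := by
      rcases Nat.lt_or_ge 1 k with h | h
      · have := hin (k - 1) (by omega) (by omega)
        simp only [Finset.mem_union, Finset.mem_insert, not_or] at this
        exact ⟨this.1, this.2.1⟩
      · obtain rfl : k = 1 := by omega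
        rw [Nat.sub_self, q0]
        exact ⟨hα.1.2, hα.2⟩
    simp only [e1, e2, qk, Nat.zero_div, q0, Nat.reduceDiv]
    exact ⟨⟨hα.1.1.1, hα.1.2⟩, ⟨hωB, hωSa⟩, ⟨hα.1.1.2, hα.2⟩, h2, hω.symm, hf, hf',
      Or.inr (Or.inr trivial), fun h => Or.inr (Or.inr (hωt h)),
      fun h => Or.inr (Or.inr (hωt (Finset.union_eq_empty.1 h).1))⟩

/-- Every vertex has at most three neighbors. -/
def IsSubcubic (G : SimpleGraph V) : Prop :=
  ∀ v a, G.Adj v a → ∃ b c, ∀ w, G.Adj v w → w = a ∨ w = b ∨ w = c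

theorem IsSubcubic.mono (h : H ≤ G) (hG : IsSubcubic G) : IsSubcubic H := fun v a ha => by
  obtain ⟨b, c, hbc⟩ := hG v a (h ha)
  exact ⟨b, c, fun w hw => hbc w (h hw)⟩

theorem IsSubcubic.exists_third (hG : IsSubcubic G) {v a b : V} (ha : G.Adj v a) (hb : G.Adj v b)
    (hab : a ≠ b) : ∃ c, ∀ w, G.Adj v w → w = a ∨ w = b ∨ w = c := by
  obtain ⟨c, d, hcd⟩ := hG v a ha
  rcases hcd b hb with h | rfl | rfl
  · exact absurd h.symm hab
  · exact ⟨d, hcd⟩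
  · exact ⟨c, fun w hw => (hcd w hw).imp_right Or.symm⟩

/-- The vertices `p 0, …, p (n - 1)` induce, in this cyclic order, a connected component which is a
cycle. The sequence `p` has period `n`. -/
structure IsCycleComponent (G : SimpleGraph V) (n : ℕ) (p : ℕ → V) : Prop where
  periodic : ∀ i, p (i + n) = p i
  inj : ∀ i j, i ≤ j → j < i + n → p i = p j → i = j
  adj_iff : ∀ i w, G.Adj (p (i + 1)) w ↔ w = p i ∨ w = p (i + 2)

theorem IsCycleComponent.adj {n : ℕ} {p : ℕ → V} (h : IsCycleComponent G n p) (i : ℕ) :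
    G.Adj (p i) (p (i + 1)) :=
  ((h.adj_iff i _).2 (Or.inl rfl)).symm

theorem IsCycleComponent.exists_succ {n : ℕ} {p : ℕ → V} (h : IsCycleComponent G n p)
    (hn : 1 ≤ n) (i : ℕ) : ∃ j, p i = p (j + 1) :=
  ⟨i + n - 1, by rw [Nat.sub_add_cancel (by omega), h.periodic]⟩

theorem IsCycleComponent.of_le {n : ℕ} {p : ℕ → V} (h : IsCycleComponent H n p) (hle : H ≤ G)
    (hp : ∀ i w, G.Adj (p i) w → H.Adj (p i) w) : IsCycleComponent G n p :=
  ⟨h.periodic, h.inj, fun i w => ⟨fun hw => (h.adj_iff i w).1 (hp _ _ hw),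
    fun hw => hle ((h.adj_iff i w).2 hw)⟩⟩

/-- Every component which is a cycle of odd length at least five contains an edge in `Z`. -/
def HitsLongOddCycles (G : SimpleGraph V) (Z : Set (Sym2 V)) : Prop :=
  ∀ n p, Odd n → 5 ≤ n → IsCycleComponent G n p → ∃ i, s(p i, p (i + 1)) ∈ Z

open Classical in
/-- The colors of the edges at `x` other than `xy`. -/
noncomputable def nearColors (H : SimpleGraph V) (c : Sym2 V → Fin 5) (x y : V) :
    Finset (Fin 5) :=
  {k | ∃ z, H.Adj x z ∧ z ≠ y ∧ c s(x, z) = k}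

open Classical in
/-- The colors of the edges not at `x` that are adjacent to an edge at `x` other than `xy`. -/
noncomputable def farColors (H : SimpleGraph V) (c : Sym2 V → Fin 5) (x y : V) :
    Finset (Fin 5) :=
  {k | ∃ w z, H.Adj x w ∧ w ≠ y ∧ H.Adj w z ∧ z ≠ x ∧ c s(w, z) = k}

theorem mem_nearColors {c : Sym2 V → Fin 5} {x y : V} {k : Fin 5} :
    k ∈ nearColors H c x y ↔ ∃ z, H.Adj x z ∧ z ≠ y ∧ c s(x, z) = k := by
  simp [nearColors]

theorem mem_farColors {c : Sym2 V → Fin 5} {x y : V} {k : Fin 5} :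
    k ∈ farColors H c x y ↔
      ∃ w z, H.Adj x w ∧ w ≠ y ∧ H.Adj w z ∧ z ≠ x ∧ c s(w, z) = k := by
  simp [farColors]

theorem nearColors_eq_empty {c : Sym2 V → Fin 5} {x y : V} (h : ∀ z, H.Adj x z → z = y) :
    nearColors H c x y = ∅ :=
  Finset.eq_empty_of_forall_notMem fun _ hk => by
    obtain ⟨z, hz, hzy, -⟩ := mem_nearColors.1 hk
    exact hzy (h z hz)

theorem farColors_eq_empty {c : Sym2 V → Fin 5} {x y : V} (h : ∀ z, H.Adj x z → z = y) :
    farColors H c x y = ∅ :=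
  Finset.eq_empty_of_forall_notMem fun _ hk => by
    obtain ⟨w, z, hw, hwy, -⟩ := mem_farColors.1 hk
    exact hwy (h w hw)

theorem nearColors_eq_singleton {c : Sym2 V → Fin 5} {x y x' : V} (hx' : H.Adj x x')
    (hne : x' ≠ y) (h : ∀ z, H.Adj x z → z = y ∨ z = x') :
    nearColors H c x y = {c s(x, x')} := by
  ext k
  rw [mem_nearColors, Finset.mem_singleton]
  constructor
  · rintro ⟨z, hz, hzy, rfl⟩
    rw [(h z hz).resolve_left hzy]
  · rintro rfl
    exact ⟨x', hx', hne, rfl⟩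

theorem exists_farColors_subset (hH : IsSubcubic H) (c : Sym2 V → Fin 5) {x y x' : V}
    (hx' : H.Adj x x') (h : ∀ z, H.Adj x z → z = y ∨ z = x') :
    ∃ α β, farColors H c x y ⊆ {α, β} := by
  obtain ⟨a, b, hab⟩ := hH x' x hx'.symm
  refine ⟨c s(x', a), c s(x', b), fun k hk => ?_⟩
  obtain ⟨w, z, hw, hwy, hwz, hzx, rfl⟩ := mem_farColors.1 hk
  obtain rfl := (h w hw).resolve_left hwy
  rcases (hab z hwz).resolve_left hzx with rfl | rfl <;> simp

theorem IsGoodColoring.notMem_farColors {Z : Set (Sym2 V)} {c : Sym2 V → Fin 5}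
    (hc : IsGoodColoring H Z c) {x y : V} (hxy : H.Adj x y) :
    c s(x, y) ∉ farColors H c x y := fun hk => by
  obtain ⟨w, z, hw, hwy, hwz, hzx, e⟩ := mem_farColors.1 hk
  refine hc.ne y x w z ⟨hxy.symm, hw, hwz, hwy.symm, hzx.symm⟩ ?_
  rw [e, Sym2.eq_swap]

/-- Orients the ear so that a last end without further neighbors occurs only when the first has none
either. The one failure left, on an isolated odd cycle, is at the edge `p (m - 1) p m` and must be
absorbed by `Z`. -/
theorem IsEar.exists_isGoodColoring_of_card {m : ℕ} {p : ℕ → V} (h : IsEar G H m p)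
    {Z Z' : Set (Sym2 V)} {c : Sym2 V → Fin 5} (hc : IsGoodColoring H Z' c)
    (hZ : ∀ v w, v ≠ p 0 → v ≠ p m → w ≠ p 0 → w ≠ p m → s(v, w) ∈ Z' → s(v, w) ∈ Z)
    (hSa : (nearColors H c (p 0) (p m)).card ≤ 1) (hSb : (nearColors H c (p m) (p 0)).card ≤ 1)
    (h4 : (farColors H c (p 0) (p m) ∪ nearColors H c (p 0) (p m) ∪ nearColors H c (p m) (p 0) ∪
      {c s(p 0, p m)}).card ≤ 4)
    (h3 : (farColors H c (p m) (p 0) ∪ nearColors H c (p 0) (p m) ∪ {c s(p 0, p m)}).card ≤ 3)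
    (ht : c s(p 0, p m) ∈ nearColors H c (p m) (p 0) → ∀ z, H.Adj (p 0) z → z = p m)
    (hlast : (∀ z, H.Adj (p m) z → z = p 0) → (∀ z, H.Adj (p 0) z → z = p m) ∧
      (Even m → m ≠ 2 → s(p (m - 1), p m) ∈ Z)) :
    ∃ c', IsGoodColoring G Z c' := by
  obtain ⟨f, ⟨hA, hSb0⟩, ⟨hB, hSa0⟩, ⟨hSa1, ht1⟩, ⟨hSb1, ht2⟩, hne, hf, hf', hx, hy, hxy⟩ :=
    exists_ear_colors _ _ (farColors H c (p m) (p 0)) _ _ h.two_le hSa hSb h4 h3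
      (hc.notMem_farColors h.close)
      (fun hmem => ⟨nearColors_eq_empty (ht hmem), farColors_eq_empty (ht hmem)⟩)
  refine h.exists_isGoodColoring hc hZ f
    (fun w z hw hwm hwz hz e => hA (mem_farColors.2 ⟨w, z, hw, hwm, hwz, hz, e.symm⟩))
    (fun z hz hz0 e => hSb0 (mem_nearColors.2 ⟨z, hz, hz0, e.symm⟩))
    (fun w z hw hwm hwz hz e => hB (mem_farColors.2 ⟨w, z, hw, hwm, hwz, hz, e.symm⟩))
    (fun z hz hz0 e => hSa0 (mem_nearColors.2 ⟨z, hz, hz0, e.symm⟩))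
    (fun z hz e => ?_) (fun z hz e => ?_) hne hf hf' (fun _ _ => hx) (fun hym hZm => ?_)
    fun hx0 hym _ => ?_
  · by_cases hzm : z = p m
    · exact ht1 (hzm ▸ e)
    · exact hSa1 (mem_nearColors.2 ⟨z, hz, hzm, e.symm⟩)
  · by_cases hzm : z = p 0
    · rw [hzm, Sym2.eq_swap] at e
      exact ht2 e
    · exact hSb1 (mem_nearColors.2 ⟨z, hz, hzm, e.symm⟩)
  · obtain ⟨hx0, hev⟩ := hlast hym
    rcases hy (by rw [farColors_eq_empty hym, nearColors_eq_empty hx0, Finset.empty_union])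
      with h2 | h2 | h2
    · exact Or.inl h2
    · by_contra hno
      exact hZm (hev h2 fun h => hno (Or.inl h))
    · exact Or.inr (Or.inl h2)
  · exact hxy (by rw [farColors_eq_empty hym, nearColors_eq_empty hx0, nearColors_eq_empty hym]; rfl)

theorem IsEar.reverse {m : ℕ} {p : ℕ → V} (h : IsEar G H m p) :
    IsEar G H m (fun i => p (m - i)) where
  two_le := h.two_le
  inj i hi j hj e := by
    have := h.inj _ (Nat.sub_le m i) _ (Nat.sub_le m j) e
    omega
  le := h.le
  adj i hi := by
    have := h.adj (m - (i + 1)) (by omega)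
    rw [show m - (i + 1) + 1 = m - i by omega] at this
    exact this.symm
  close := by
    simp only [Nat.sub_zero, Nat.sub_self]
    exact h.close.symm
  inner i h0 hi w := h.inner (m - i) (by omega) (by omega) w
  cover u v huv := by
    refine (h.cover u v huv).imp_right ?_
    rintro ⟨i, hi, e⟩
    refine ⟨m - (i + 1), by omega, ?_⟩
    rw [e, show m - (m - (i + 1)) = i + 1 by omega,
      show m - (m - (i + 1) + 1) = i by omega, Sym2.eq_swap]

/-- A good coloring extends to an ear, with suitable exceptions for cycle components. -/
theorem IsEar.exists_isGoodColoring_of_isGoodColoring {m : ℕ} {p : ℕ → V} (h : IsEar G H m p)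
    (hG : IsSubcubic G) {Z Z' : Set (Sym2 V)} {c : Sym2 V → Fin 5} (hc : IsGoodColoring H Z' c)
    (hZ : ∀ v w, v ≠ p 0 → v ≠ p m → w ≠ p 0 → w ≠ p m → s(v, w) ∈ Z' → s(v, w) ∈ Z)
    (hZ' : s(p 0, p m) ∉ Z')
    (hcyc : (∀ z, H.Adj (p m) z → z = p 0) → (∀ z, H.Adj (p 0) z → z = p m) →
      Even m → m ≠ 2 → s(p (m - 1), p m) ∈ Z) :
    ∃ c', IsGoodColoring G Z c' := by
  have hH := hG.mono h.le
  have hm := h.two_le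
  have sw : ∀ u v, c s(u, v) = c s(v, u) := fun u v => by rw [Sym2.eq_swap]
  have third0 : ∃ x', ∀ z, H.Adj (p 0) z → z = p m ∨ z = x' := by
    obtain ⟨x', hx'⟩ := hG.exists_third (h.adj 0 (by omega)) (h.le h.close) fun e => by
      have := h.inj _ (by omega) _ le_rfl e
      omega
    exact ⟨x', fun z hz => (hx' z (h.le hz)).resolve_left fun e =>
      h.inner 1 (by omega) (by omega) _ (by simpa using e ▸ hz.symm)⟩
  have thirdm : ∃ y', ∀ z, H.Adj (p m) z → z = p 0 ∨ z = y' := by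
    have ha := (h.adj (m - 1) (by omega)).symm
    rw [Nat.sub_add_cancel (by omega)] at ha
    obtain ⟨y', hy'⟩ := hG.exists_third ha (h.le h.close.symm) fun e => by
      have := h.inj _ (by omega) _ (by omega) e
      omega
    exact ⟨y', fun z hz => (hy' z (h.le hz)).resolve_left fun e =>
      h.inner (m - 1) (by omega) (by omega) _ (e ▸ hz.symm)⟩
  obtain ⟨x', hx'⟩ := third0
  obtain ⟨y', hy'⟩ := thirdm
  have sub4 : ∀ {S : Finset (Fin 5)} {a b d e : Fin 5}, S ⊆ {a, b, d, e} → S.card ≤ 4 :=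
    fun hS => (Finset.card_le_card hS).trans Finset.card_le_four
  have sub3 : ∀ {S : Finset (Fin 5)} {a b d : Fin 5}, S ⊆ {a, b, d} → S.card ≤ 3 :=
    fun hS => (Finset.card_le_card hS).trans Finset.card_le_three
  by_cases hx0 : ∀ z, H.Adj (p 0) z → z = p m
  · have eA := farColors_eq_empty (c := c) hx0
    have eS := nearColors_eq_empty (c := c) hx0
    by_cases hym : ∀ z, H.Adj (p m) z → z = p 0
    · have eB := farColors_eq_empty (c := c) hym
      have eT := nearColors_eq_empty (c := c) hym
      exact h.exists_isGoodColoring_of_card hc hZ (by simp [eS]) (by simp [eT])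
        (by simp [eA, eS, eT]) (by simp [eB, eS]) (fun _ => hx0)
        fun hym => ⟨hx0, hcyc hym hx0⟩
    · push Not at hym
      obtain ⟨z, hz, hz0⟩ := hym
      obtain rfl := (hy' z hz).resolve_left hz0
      have eT := nearColors_eq_singleton (c := c) hz hz0 hy'
      obtain ⟨α, β, hB⟩ := exists_farColors_subset hH c hz hy'
      refine h.exists_isGoodColoring_of_card hc hZ (by simp [eS]) (by simp [eT])
        ?_ (sub3 (a := α) (b := β) (d := c s(p 0, p m)) ?_) (fun _ => hx0)
        fun hym => absurd (hym _ hz) hz0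
      · rw [eA, eS, eT]
        exact (Finset.card_union_le _ _).trans (by simp)
      · rw [eS]
        grind
  · push Not at hx0
    obtain ⟨z, hz, hzm⟩ := hx0
    obtain rfl := (hx' z hz).resolve_left hzm
    have eS := nearColors_eq_singleton (c := c) hz hzm hx'
    obtain ⟨α, β, hA⟩ := exists_farColors_subset hH c hz hx'
    have hZrev : ∀ v w, v ≠ p m → v ≠ p 0 → w ≠ p m → w ≠ p 0 → s(v, w) ∈ Z' → s(v, w) ∈ Z :=
      fun v w h1 h2 h3 h4 => hZ v w h2 h1 h4 h3
    by_cases hym : ∀ z, H.Adj (p m) z → z = p 0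
    · have eB := farColors_eq_empty (c := c) hym
      have eT := nearColors_eq_empty (c := c) hym
      -- Reversal puts the end without further neighbors first.
      refine h.reverse.exists_isGoodColoring_of_card hc (by simpa using hZrev)
        (by simp [eT]) (by simp [eS]) ?_
        (sub3 (a := α) (b := β) (d := c s(p m, p 0)) ?_) (by simpa using fun _ => hym) ?_
      · simp only [Nat.sub_zero, Nat.sub_self, eB, eS, eT]
        exact (Finset.card_union_le _ _).trans (by simp)
      · simp only [Nat.sub_zero, Nat.sub_self, eT]
        grind
      · simp only [Nat.sub_zero, Nat.sub_self]
        exact fun hx0 => absurd (hx0 _ hz) hzm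
    · push Not at hym
      obtain ⟨w, hw, hw0⟩ := hym
      obtain rfl := (hy' w hw).resolve_left hw0
      have eT := nearColors_eq_singleton (c := c) hw hw0 hy'
      obtain ⟨γ, δ, hB⟩ := exists_farColors_subset hH c hw hy'
      have hne : c s(z, p 0) ≠ c s(p m, w) :=
        hc.ne z (p 0) (p m) w ⟨hz.symm, h.close, hw, hzm, hw0.symm⟩
      rw [sw z] at hne
      -- The crude counts `2 + 1 + 1 + 1` and `2 + 1 + 1` exceed the bounds `4` and `3` by one. If
      -- `z = w`, the near color of each end is a far color of the other. If not, the two-color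
      -- condition on `z, p 0, p m, w` makes the closing color a near color; reversal brings it to
      -- the first end if necessary.
      by_cases hzw : z = w
      · subst hzw
        have hbA : c s(p m, z) ∈ farColors H c (p 0) (p m) :=
          mem_farColors.2 ⟨z, p m, hz, hzm, hw.symm, h.ne_zero_last.symm, sw _ _⟩
        have haB : c s(p 0, z) ∈ farColors H c (p m) (p 0) :=
          mem_farColors.2 ⟨z, p 0, hw, hw0, hz.symm, h.ne_zero_last, sw _ _⟩
        have htA := hc.notMem_farColors h.close
        refine h.exists_isGoodColoring_of_card hc hZ (by simp [eS]) (by simp [eT])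
          (sub4 (a := α) (b := β) (d := c s(p 0, z)) (e := c s(p 0, p m)) ?_)
          (sub3 (a := γ) (b := δ) (d := c s(p 0, p m)) ?_) (fun ht => ?_)
          fun hym => absurd (hym _ hw) hw0
        · rw [eS, eT]
          grind
        · rw [eS]
          grind
        · rw [eT, Finset.mem_singleton] at ht
          exact absurd hbA (ht ▸ htA)
      · rcases hc.eq_or_eq z (p 0) (p m) w ⟨⟨hz.symm, h.close, hw, hzm, hw0.symm⟩, hzw,
          fun v hv => (hx' v hv).symm, hy'⟩ hZ' with ht | ht
        · rw [sw z] at ht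
          refine h.exists_isGoodColoring_of_card hc hZ (by simp [eS]) (by simp [eT])
            (sub4 (a := α) (b := β) (d := c s(p 0, z)) (e := c s(p m, w)) ?_)
            (sub3 (a := γ) (b := δ) (d := c s(p 0, z)) ?_) (fun ht' => ?_)
            fun hym => absurd (hym _ hw) hw0
          · rw [eS, eT, ht]
            grind
          · rw [eS, ht]
            grind
          · rw [eT, Finset.mem_singleton, ht] at ht'
            exact absurd ht' hne
        · refine h.reverse.exists_isGoodColoring_of_card hc (by simpa using hZrev)
            (by simp [eT]) (by simp [eS])
            (sub4 (a := γ) (b := δ) (d := c s(p 0, z)) (e := c s(p m, w)) ?_)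
            (sub3 (a := α) (b := β) (d := c s(p m, w)) ?_) ?_ ?_
          · simp only [Nat.sub_zero, Nat.sub_self, eS, eT, sw (p m) (p 0), ht]
            grind
          · simp only [Nat.sub_zero, Nat.sub_self, eT, sw (p m) (p 0), ht]
            grind
          · simp only [Nat.sub_zero, Nat.sub_self, eS, sw (p m) (p 0), ht, Finset.mem_singleton]
            exact fun e => absurd e.symm hne
          · simp only [Nat.sub_zero, Nat.sub_self]
            exact fun hx0 => absurd (hx0 _ hz) hzm

end Coloring

/-! ### Induction by removing pendant edges and ears -/

section Main

variable {V : Type*} {G : SimpleGraph V}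

/-- A good coloring extends to a pendant edge. -/
theorem exists_isGoodColoring_of_pendant (hG : IsSubcubic G) {u y : V} (huy : G.Adj u y)
    (hu : ∀ w, G.Adj u w → w = y) {Z Z' : Set (Sym2 V)} {c : Sym2 V → Fin 5}
    (hc : IsGoodColoring (G.deleteEdges {s(u, y)}) Z' c)
    (hZ : ∀ v w, v ≠ y → w ≠ y → s(v, w) ∈ Z' → s(v, w) ∈ Z) :
    ∃ c', IsGoodColoring G Z c' := by
  classical
  have hcard : (farColors G c y u).card ≤ 4 := by
    obtain ⟨a, b, hab⟩ := hG y u huy.symm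
    have hfar : ∀ z, ∃ α β, ∀ w, G.Adj y z → G.Adj z w → w ≠ y →
        c s(z, w) = α ∨ c s(z, w) = β := by
      intro z
      by_cases hz : G.Adj y z
      · obtain ⟨d, e, hde⟩ := hG z y hz.symm
        refine ⟨c s(z, d), c s(z, e), fun w _ hw hwy => ?_⟩
        rcases (hde w hw).resolve_left hwy with rfl | rfl
        · exact Or.inl rfl
        · exact Or.inr rfl
      · exact ⟨0, 0, fun w h => absurd h hz⟩
    obtain ⟨α, β, h1⟩ := hfar a
    obtain ⟨γ, δ, h2⟩ := hfar b
    refine (Finset.card_le_card (t := {α, β, γ, δ}) fun k hk => ?_).trans Finset.card_le_four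
    obtain ⟨z, w, hz, hzu, hzw, hwy, rfl⟩ := mem_farColors.1 hk
    rcases (hab z hz).resolve_left hzu with rfl | rfl
    · rcases h1 w hz hzw hwy with e | e <;> simp [e]
    · rcases h2 w hz hzw hwy with e | e <;> simp [e]
  -- If `y` has a single further neighbor `z`, the color of `yz` is repeated on `uy` when allowed.
  -- When it is not and `z` has degree two, the edge following `yz` already has the color of `yz`.
  -- Either way the simple path has two colors.
  obtain ⟨r, hr, hr'⟩ : ∃ r, r ∉ farColors G c y u ∧ ∀ z, (∀ w, G.Adj y w → w = u ∨ w = z) →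
      G.Adj y z → z ≠ u → c s(y, z) ∉ farColors G c y u → c s(y, z) = r := by
    by_cases h : ∃ z, (∀ w, G.Adj y w → w = u ∨ w = z) ∧ c s(y, z) ∉ farColors G c y u
    · obtain ⟨z, hz, hzf⟩ := h
      exact ⟨_, hzf, fun z' _ hyz' hz'u _ => by rw [(hz z' hyz').resolve_left hz'u]⟩
    · obtain ⟨r, hr⟩ := exists_notMem_of_card_le_four hcard
      exact ⟨r, hr, fun z hz _ _ hzf => absurd ⟨z, hz, hzf⟩ h⟩
  have hadj : ∀ {a b}, G.Adj a b → a ≠ u → b ≠ u → (G.deleteEdges {s(u, y)}).Adj a b := by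
    intro a b hab ha hb
    rw [deleteEdges_adj]
    refine ⟨hab, fun h => ?_⟩
    rcases Sym2.eq_iff.1 h with ⟨h, -⟩ | ⟨-, h⟩
    · exact ha h
    · exact hb h
  set c' := Function.update c s(u, y) r with hc'
  have hcu : c' s(u, y) = r := Function.update_self _ _ _
  have hce : ∀ {a b}, a ≠ u → b ≠ u → c' s(a, b) = c s(a, b) := by
    intro a b ha hb
    refine Function.update_of_ne (fun h => ?_) _ _
    rcases Sym2.eq_iff.1 h with ⟨h, -⟩ | ⟨-, h⟩
    · exact ha h
    · exact hb h
  have sw : ∀ a b, c' s(a, b) = c' s(b, a) := fun a b => by rw [Sym2.eq_swap]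
  have inner : ∀ {a v w x}, Consecutive G a v w x → v ≠ u ∧ w ≠ u := by
    rintro a v w x ⟨hav, hvw, hwx, haw, hvx⟩
    constructor
    · rintro rfl
      exact haw ((hu _ hav.symm).trans (hu _ hvw).symm)
    · rintro rfl
      exact hvx ((hu _ hvw.symm).trans (hu _ hwx).symm)
  have rev : ∀ {a v w x}, Consecutive G a v w x → Consecutive G x w v a :=
    fun h => ⟨h.2.2.1.symm, h.2.1.symm, h.1.symm, h.2.2.2.2.symm, h.2.2.2.1.symm⟩
  have first : ∀ {v w x}, Consecutive G u v w x → v = y ∧ x ≠ u := by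
    rintro v w x h
    obtain rfl := hu _ h.1
    refine ⟨rfl, ?_⟩
    rintro rfl
    exact h.2.1.ne (hu _ h.2.2.1.symm).symm
  have key1 : ∀ v w x, Consecutive G u v w x → c' s(u, v) ≠ c' s(w, x) := by
    intro v w x h
    obtain ⟨rfl, hx⟩ := first h
    rw [hcu, hce (inner h).2 hx]
    exact fun e => hr (mem_farColors.2 ⟨w, x, h.2.1, (inner h).2, h.2.2.1, h.2.2.2.2.symm, e.symm⟩)
  have key2 : ∀ v w x, IsSimpleThreePath G u v w x →
      c' s(v, w) = c' s(u, v) ∨ c' s(v, w) = c' s(w, x) := by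
    intro v w x h
    obtain ⟨rfl, hx⟩ := first h.1
    have hin := inner h.1
    rw [hcu, hce hin.1 hin.2, hce hin.2 hx]
    by_cases hf : c s(v, w) ∈ farColors G c v u
    · obtain ⟨z, t, hz, hzu, hzt, htv, e⟩ := mem_farColors.1 hf
      obtain rfl := (h.left z hz).resolve_left hzu
      obtain rfl := (h.right t hzt).resolve_left htv
      exact Or.inr e.symm
    · exact Or.inl (hr' w h.left h.1.2.1 hin.2 hf)
  refine ⟨c', fun a v w x h => ?_, fun a v w x h hZvw => ?_⟩
  · by_cases ha : a = u
    · subst ha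
      exact key1 v w x h
    by_cases hx : x = u
    · subst hx
      rw [sw a, sw w]
      exact (key1 w v a (rev h)).symm
    have hin := inner h
    rw [hce ha hin.1, hce hin.2 hx]
    exact hc.ne a v w x ⟨hadj h.1 ha hin.1, hadj h.2.1 hin.1 hin.2, hadj h.2.2.1 hin.2 hx,
      h.2.2.2⟩
  · by_cases ha : a = u
    · subst ha
      exact key2 v w x h
    by_cases hx : x = u
    · subst hx
      rw [sw a, sw w, sw v]
      exact (key2 w v a ⟨rev h.1, h.ne.symm, fun z hz => (h.right z hz).symm,
        fun z hz => (h.left z hz).symm⟩).symm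
    have hin := inner h.1
    have hle := G.deleteEdges_le {s(u, y)}
    have hvy : v ≠ y := by
      rintro rfl
      rcases h.left u huy.symm with e | e
      · exact ha e.symm
      · exact hin.2 e.symm
    have hwy : w ≠ y := by
      rintro rfl
      rcases h.right u huy.symm with e | e
      · exact hin.1 e.symm
      · exact hx e.symm
    rw [hce ha hin.1, hce hin.2 hx, hce hin.1 hin.2]
    exact hc.eq_or_eq a v w x ⟨⟨hadj h.1.1 ha hin.1, hadj h.1.2.1 hin.1 hin.2,
      hadj h.1.2.2.1 hin.2 hx, h.1.2.2.2⟩, h.ne, fun z hz => h.left z (hle hz),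
      fun z hz => h.right z (hle hz)⟩ fun hm => hZvw (hZ v w hvy hwy hm)

/-- A cycle `p 0, …, p m` all of whose vertices except `p 0` and `p m` have degree two. -/
structure IsEndCycle (G : SimpleGraph V) (m : ℕ) (p : ℕ → V) : Prop where
  two_le : 2 ≤ m
  inj : ∀ i ≤ m, ∀ j ≤ m, p i = p j → i = j
  adj : ∀ i < m, G.Adj (p i) (p (i + 1))
  close : G.Adj (p 0) (p m)
  inner : ∀ i, 0 < i → i < m → ∀ w, G.Adj (p i) w → w = p (i - 1) ∨ w = p (i + 1)

theorem IsEndCycle.isCycleComponent {m : ℕ} {p : ℕ → V} (h : IsEndCycle G m p)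
    (h0 : ∀ z, G.Adj (p 0) z → z = p 1 ∨ z = p m)
    (hm : ∀ z, G.Adj (p m) z → z = p (m - 1) ∨ z = p 0) :
    IsCycleComponent G (m + 1) (fun i => p (i % (m + 1))) := by
  have h2 := h.two_le
  refine ⟨fun i => by simp, fun i j hij hj e => ?_, fun i w => ?_⟩
  · have h1 := h.inj _ (Nat.lt_succ_iff.1 (Nat.mod_lt i (Nat.succ_pos m))) _
      (Nat.lt_succ_iff.1 (Nat.mod_lt j (Nat.succ_pos m))) e
    have h2 : (j - i) % (m + 1) = 0 := Nat.sub_mod_eq_zero_of_mod_eq h1.symm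
    rw [Nat.mod_eq_of_lt (by omega)] at h2
    omega
  · have e1 : (i + 1) % (m + 1) = (i % (m + 1) + 1) % (m + 1) := by simp
    have e2 : (i + 2) % (m + 1) = (i % (m + 1) + 2) % (m + 1) := by simp
    have hlt : i % (m + 1) < m + 1 := Nat.mod_lt i (Nat.succ_pos m)
    simp only [e1, e2]
    generalize i % (m + 1) = r at hlt
    rcases (by omega : r + 1 < m ∨ r + 1 = m ∨ r = m) with hr | rfl | rfl
    · rw [Nat.mod_eq_of_lt (by omega), Nat.mod_eq_of_lt (by omega)]
      refine ⟨h.inner (r + 1) (by omega) hr w, ?_⟩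
      rintro (rfl | rfl)
      · exact (h.adj r (by omega)).symm
      · exact h.adj (r + 1) hr
    · rw [Nat.mod_eq_of_lt (by omega), show r + 2 = r + 1 + 1 by omega, Nat.mod_self]
      refine ⟨hm w, ?_⟩
      rintro (rfl | rfl)
      · exact (h.adj r (by omega)).symm
      · exact h.close.symm
    · rw [Nat.mod_self, show r + 2 = 1 + (r + 1) by omega, Nat.add_mod_right,
        Nat.mod_eq_of_lt (by omega)]
      refine ⟨fun hw => (h0 w hw).symm, ?_⟩
      rintro (rfl | rfl)
      · exact h.close
      · exact h.adj 0 (by omega)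

theorem IsCycleComponent.isEndCycle {m : ℕ} {P : ℕ → V} (h : IsCycleComponent G (m + 1) P)
    (hm : 2 ≤ m) (s : ℕ) : IsEndCycle G m (fun j => P (s + j)) where
  two_le := hm
  inj i hi j hj e := by
    rcases le_total i j with hij | hij
    · have := h.inj (s + i) (s + j) (by omega) (by omega) e
      omega
    · have := h.inj (s + j) (s + i) (by omega) (by omega) e.symm
      omega
  adj i _ := h.adj (s + i)
  close := by
    have := h.adj (s + m)
    rw [show s + m + 1 = s + (m + 1) by omega, h.periodic] at this
    exact this.symm
  inner i h0 _ w hw := by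
    have := (h.adj_iff (s + (i - 1)) w).1 (by rwa [show s + (i - 1) + 1 = s + i by omega])
    rwa [show s + (i - 1) + 2 = s + (i + 1) by omega] at this

/-- On an isolated odd cycle of length at least five any edge can serve as the closing edge.
Starting two steps after an edge of `Z` makes that edge the last one of the ear, where the coloring
may fail. -/
theorem IsEndCycle.exists_rotation {m : ℕ} {p : ℕ → V} (h : IsEndCycle G m p)
    {Z : Set (Sym2 V)} (hZ : HitsLongOddCycles G Z) :
    ∃ p', IsEndCycle G m p' ∧ ((∀ z, G.Adj (p' 0) z → z = p' 1 ∨ z = p' m) →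
      (∀ z, G.Adj (p' m) z → z = p' (m - 1) ∨ z = p' 0) → Even m → m ≠ 2 →
        s(p' (m - 1), p' m) ∈ Z) := by
  by_cases hall : (∀ z, G.Adj (p 0) z → z = p 1 ∨ z = p m) ∧
      (∀ z, G.Adj (p m) z → z = p (m - 1) ∨ z = p 0) ∧ Even m ∧ m ≠ 2
  · obtain ⟨h0, hm, hev, hm2⟩ := hall
    have h2 := h.two_le
    have hP := h.isCycleComponent h0 hm
    have h4 : 5 ≤ m + 1 := by
      obtain ⟨k, rfl⟩ := hev
      omega
    obtain ⟨i, hi⟩ := hZ (m + 1) _ hev.add_one h4 hP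
    refine ⟨_, hP.isEndCycle h2 (i + 2), fun _ _ _ _ => ?_⟩
    have e1 : i + 2 + (m - 1) = i + (m + 1) := by omega
    have e2 : i + 2 + m = i + 1 + (m + 1) := by omega
    simp only [e1, e2, Nat.add_mod_right]
    exact hi
  · exact ⟨p, h, fun a b d e => absurd ⟨a, b, d, e⟩ hall⟩

theorem IsEndCycle.isEar {m : ℕ} {p : ℕ → V} (h : IsEndCycle G m p) :
    IsEar G (G.deleteEdges {e | ∃ i < m, e = s(p i, p (i + 1))}) m p where
  two_le := h.two_le
  inj := h.inj
  le := G.deleteEdges_le _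
  adj := h.adj
  close := by
    have h2 := h.two_le
    rw [deleteEdges_adj]
    refine ⟨h.close, ?_⟩
    rintro ⟨i, hi, e⟩
    rcases Sym2.eq_iff.1 e with ⟨e1, e2⟩ | ⟨e1, e2⟩
    · have := h.inj _ (by omega) _ hi.le e1
      have := h.inj _ le_rfl _ hi e2
      omega
    · have := h.inj _ (by omega) _ hi e1
      omega
  inner i h0 hi w hw := by
    rw [deleteEdges_adj] at hw
    rcases h.inner i h0 hi w hw.1 with rfl | rfl
    · refine hw.2 ⟨i - 1, by omega, ?_⟩
      rw [Nat.sub_add_cancel h0, Sym2.eq_swap]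
    · exact hw.2 ⟨i, hi, rfl⟩
  cover u v huv := by
    by_cases he : ∃ i < m, s(u, v) = s(p i, p (i + 1))
    · exact Or.inr he
    · exact Or.inl ((deleteEdges_adj).2 ⟨huv, he⟩)

/-- A cycle component of `H` through `p 0` has an edge at `p 0` other than `p 0 p m`. One avoiding
`p 0` also avoids its `H`-neighbor `p m`, so it is a component of `G` already. The closing edge is
never exempted, as its two-color property drives the extension. -/
theorem HitsLongOddCycles.of_isEar {H : SimpleGraph V} {m : ℕ} {p : ℕ → V} {Z : Set (Sym2 V)}
    (hZ : HitsLongOddCycles G Z) (h : IsEar G H m p) :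
    HitsLongOddCycles H {e | e ≠ s(p 0, p m) ∧ (e ∈ Z ∨ p 0 ∈ e)} := by
  intro n P hn h5 hP
  have hsucc := hP.exists_succ (by omega)
  by_cases h0 : ∃ i, P (i + 1) = p 0
  · obtain ⟨i, hi⟩ := h0
    by_cases him : P i = p m
    · refine ⟨i + 1, fun e => ?_, Or.inr (by simp [hi])⟩
      rw [hi, ← him, Sym2.eq_iff] at e
      have h1 := hP.inj i (i + 1 + 1) (by omega) (by omega)
      rcases e with ⟨-, e⟩ | ⟨e, -⟩
      · have := h1 e.symm
        omega
      · exact h.ne_zero_last (e.trans him)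
    · refine ⟨i, fun e => ?_, Or.inr (by simp [hi])⟩
      rw [hi, Sym2.eq_iff] at e
      rcases e with ⟨-, e⟩ | ⟨e, -⟩
      · exact h.ne_zero_last e
      · exact him e
  · push Not at h0
    have h0' : ∀ i, P i ≠ p 0 := fun i => by
      obtain ⟨j, hj⟩ := hsucc i
      rw [hj]
      exact h0 j
    have hm' : ∀ i, P i ≠ p m := fun i hi => by
      obtain ⟨j, hj⟩ := hsucc i
      rcases (hP.adj_iff j (p 0)).1 (by rw [← hj, hi]; exact h.close.symm) with e | e
      · exact h0' _ e.symm
      · exact h0' _ e.symm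
    obtain ⟨i, hi⟩ := hZ n P hn h5 (hP.of_le h.le fun i w hw =>
      (h.adj_of_adj (hP.adj i) hw).resolve_right (by
        rintro (⟨e, -⟩ | ⟨e, -⟩)
        · exact h0' i e
        · exact hm' i e))
    refine ⟨i, fun e => ?_, Or.inl hi⟩
    rcases Sym2.eq_iff.1 e with ⟨e, -⟩ | ⟨e, -⟩
    · exact h0' i e
    · exact hm' i e

/-- Only a cycle through `y` can be newly isolated. Exempting the edges at `y` is harmless: in `G` a
simple three-edge path with inner vertex `y` contains `uy` as an end edge and is handled directly.
-/
theorem HitsLongOddCycles.deleteEdges_pendant {Z : Set (Sym2 V)} (hZ : HitsLongOddCycles G Z)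
    {u y : V} (hu : ∀ w, G.Adj u w → w = y) :
    HitsLongOddCycles (G.deleteEdges {s(u, y)}) (Z ∪ {e | y ∈ e}) := by
  intro n P hn h5 hP
  by_cases hy : ∃ i, P i = y
  · obtain ⟨i, hi⟩ := hy
    exact ⟨i, Or.inr (by simp [hi])⟩
  · push Not at hy
    obtain ⟨i, hi⟩ := hZ n P hn h5 (hP.of_le (G.deleteEdges_le _) fun i w hw => by
      rw [deleteEdges_adj]
      refine ⟨hw, fun e => ?_⟩
      rcases Sym2.eq_iff.1 e with ⟨e, -⟩ | ⟨e, -⟩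
      · have h1 := (deleteEdges_adj.1 (hP.adj i)).1
        rw [e] at h1
        exact hy _ (hu _ h1)
      · exact hy i e)
    exact ⟨i, Or.inl hi⟩

/-- A subcubic graph without `K₄` and `K₂,₃` minors has a good coloring. -/
theorem exists_isGoodColoring [Finite V] (G : SimpleGraph V) (hG : IsSubcubic G)
    (h4 : ¬ HasMinor (completeGraph (Fin 4)) G)
    (h23 : ¬ HasMinor (completeBipartiteGraph (Fin 2) (Fin 3)) G) {Z : Set (Sym2 V)}
    (hZ : HitsLongOddCycles G Z) : ∃ c, IsGoodColoring G Z c := by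
  induction G using WellFoundedLT.induction generalizing Z with
  | ind G ih =>
    by_cases hleaf : ∃ u y, G.Adj u y ∧ ∀ w, G.Adj u w → w = y
    · obtain ⟨u, y, huy, hu⟩ := hleaf
      have hle := G.deleteEdges_le {s(u, y)}
      have hlt : G.deleteEdges {s(u, y)} < G := lt_of_le_of_ne hle fun e => by
        have : (G.deleteEdges {s(u, y)}).Adj u y := e.symm ▸ huy
        rw [deleteEdges_adj] at this
        exact this.2 rfl
      obtain ⟨c, hc⟩ := ih _ hlt (hG.mono hle) (fun h => h4 (h.mono hle))
        (fun h => h23 (h.mono hle)) (hZ.deleteEdges_pendant hu)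
      refine exists_isGoodColoring_of_pendant hG huy hu hc fun v w hv hw hmem => ?_
      refine hmem.resolve_right fun h => ?_
      rcases Sym2.mem_iff.1 h with h | h
      · exact hv h.symm
      · exact hw h.symm
    · by_cases hedge : ∃ a b, G.Adj a b
      · obtain ⟨a, b, hab⟩ := hedge
        obtain ⟨m, p, h2, hinj, hadj, hclose, hinner⟩ := exists_end_cycle h4 h23
          (fun v w hvw => by
            by_contra! hno
            exact hleaf ⟨v, w, hvw, fun w' hw' => by
              by_contra hne
              exact hno w' hne hw'⟩) hab
        obtain ⟨p, hp, hrot⟩ :=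
          IsEndCycle.exists_rotation ⟨h2, hinj, hadj, hclose, hinner⟩ hZ
        have hear := hp.isEar
        generalize G.deleteEdges {e | ∃ i < m, e = s(p i, p (i + 1))} = H at hear
        have hlt : H < G := lt_of_le_of_ne hear.le fun e =>
          hear.not_adj (i := 0) (by omega) (e.symm ▸ hp.adj 0 (by omega))
        obtain ⟨c, hc⟩ := ih H hlt (hG.mono hear.le) (fun h => h4 (h.mono hear.le))
          (fun h => h23 (h.mono hear.le)) (hZ.of_isEar hear)
        refine hear.exists_isGoodColoring_of_isGoodColoring hG hc
          (fun v w hv0 _ hw0 _ hmem => ?_) (fun h => h.1 rfl) fun hm h0 hev hm2 => ?_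
        · refine hmem.2.resolve_right fun h => ?_
          rcases Sym2.mem_iff.1 h with h | h
          · exact hv0 h.symm
          · exact hw0 h.symm
        · refine hrot (fun z hz => ?_) (fun z hz => ?_) hev hm2
          · exact (hear.adj_zero hz).symm.imp_right (h0 z)
          · exact (hear.adj_last hz).symm.imp_right (hm z)
      · push Not at hedge
        exact ⟨fun _ => 0, fun u v w x h => absurd h.1 (hedge u v),
          fun u v w x h => absurd h.1.1 (hedge u v)⟩

end Main

/-! ### From good colorings to the stated bounds -/

section Transfer

variable {V : Type*} {G : SimpleGraph V}

theorem IsCycleComponent.apply_inj {n : ℕ} {p : ℕ → V} (h : IsCycleComponent G n p) {a b : ℕ}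
    (ha : a < n) (hb : b < n) (e : p a = p b) : a = b := by
  rcases le_total a b with hab | hab
  · exact h.inj a b hab (by omega) e
  · exact (h.inj b a hab (by omega) e.symm).symm

theorem IsCycleComponent.adj_iff_cycleGraph_adj {n : ℕ} {p : ℕ → V}
    (h : IsCycleComponent G n p) (a b : Fin n) :
    G.Adj (p a) (p b) ↔ (cycleGraph n).Adj a b := by
  have hval : ∀ a b : Fin n, (a - b).val = 1 → p a = p (b + 1) := by
    intro a b e
    rcases le_or_gt b a with hba | hba
    · rw [Fin.sub_val_of_le hba] at e
      rw [show a.val = b + 1 by omega]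
    · rw [Fin.coe_sub_iff_lt.2 hba] at e
      rw [show b.val + 1 = a.val + n by omega, h.periodic]
  have hval' : ∀ a b : Fin n, p a = p (b + 1) → (2 ≤ n) → (a - b).val = 1 := by
    intro a b e hn
    rcases Nat.lt_or_ge (b.val + 1) n with hb | hb
    · have := h.apply_inj a.2 hb e
      rw [Fin.sub_val_of_le (Fin.le_def.2 (by omega))]
      omega
    · have hb' : b.val + 1 = 0 + n := by omega
      rw [hb', h.periodic] at e
      have := h.apply_inj a.2 (by omega) e
      rw [Fin.coe_sub_iff_lt.2 (Fin.lt_def.2 (by omega))]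
      omega
  have hn : 2 ≤ n ∨ n = 1 := by have := a.2; omega
  rcases hn with hn | rfl
  · rw [cycleGraph_adj']
    refine ⟨fun hab => ?_, ?_⟩
    · have h1 := (h.adj_iff (a + n - 1) (p b)).1 (by
        rwa [Nat.sub_add_cancel (by omega), h.periodic])
      rw [show a + n - 1 + 2 = a + 1 + n by omega, h.periodic] at h1
      rcases h1 with e | e
      · left
        refine hval' a b ?_ hn
        rcases Nat.eq_zero_or_pos a.val with ha | ha
        · have := h.apply_inj b.2 (by omega) e
          rw [show b.val + 1 = a.val + n by omega, h.periodic]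
        · rw [show a + n - 1 = a - 1 + n by omega, h.periodic] at e
          have := h.apply_inj b.2 (by omega) e
          rw [show b.val + 1 = a.val by omega]
      · exact Or.inr (hval' b a e hn)
    · rintro (e | e)
      · rw [hval a b e]
        exact (h.adj b).symm
      · rw [hval b a e]
        exact h.adj a
  · obtain rfl : a = b := Subsingleton.elim _ _
    simp

theorem IsCycleComponent.exists_iso {n : ℕ} {p : ℕ → V} (h : IsCycleComponent G n p)
    (hn : 1 ≤ n) : Nonempty ((G.connectedComponentMk (p 0)).toSimpleGraph ≃g cycleGraph n) := by
  have hreach : ∀ i, G.Reachable (p i) (p 0) := by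
    intro i
    induction i with
    | zero => exact .rfl
    | succ i ih => exact (h.adj i).symm.reachable.trans ih
  have hsurj : ∀ v, G.Reachable (p 0) v → ∃ i, v = p i := by
    intro v hv
    rw [reachable_iff_reflTransGen] at hv
    induction hv with
    | refl => exact ⟨0, rfl⟩
    | tail _ hvw ih =>
      obtain ⟨i, rfl⟩ := ih
      obtain ⟨j, hj⟩ := h.exists_succ hn i
      rw [hj] at hvw
      rcases (h.adj_iff j _).1 hvw with e | e
      · exact ⟨j, e⟩
      · exact ⟨j + 2, e⟩
  have hper : ∀ k i, p (i + k * n) = p i := by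
    intro k
    induction k with
    | zero => simp
    | succ k ih =>
      intro i
      rw [Nat.succ_mul, ← add_assoc, h.periodic, ih]
  let f : Fin n → (G.connectedComponentMk (p 0)).supp := fun i =>
    ⟨p i, ConnectedComponent.eq.2 (hreach i)⟩
  have hf : Function.Bijective f := by
    refine ⟨fun i j e => Fin.ext (h.apply_inj i.2 j.2 (congrArg Subtype.val e)), ?_⟩
    rintro ⟨v, hv⟩
    obtain ⟨i, rfl⟩ := hsurj v (ConnectedComponent.eq.1 hv).symm
    refine ⟨⟨i % n, Nat.mod_lt _ hn⟩, Subtype.ext ?_⟩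
    have := hper (i / n) (i % n)
    rw [Nat.mod_add_div' i n] at this
    exact this.symm
  exact ⟨RelIso.symm ⟨Equiv.ofBijective f hf, fun {a b} => h.adj_iff_cycleGraph_adj a b⟩⟩

theorem NoLongOddCycleComponent.hitsLongOddCycles (h : NoLongOddCycleComponent G)
    (Z : Set (Sym2 V)) : HitsLongOddCycles G Z := fun n _ hn h5 hp =>
  (h _ n hn h5).elim (hp.exists_iso (by omega)).some

theorem isSubcubic_of_maxDegree [Fintype V] [DecidableRel G.Adj] (h : G.maxDegree ≤ 3) :
    IsSubcubic G := by
  classical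
  intro v a ha
  have h1 : ((G.neighborFinset v).erase a).card ≤ 2 := by
    rw [Finset.card_erase_of_mem ((G.mem_neighborFinset v a).2 ha), card_neighborFinset_eq_degree]
    have := G.degree_le_maxDegree v
    omega
  have h2 : ∃ b c, (G.neighborFinset v).erase a ⊆ {b, c} := by
    rcases (by omega : ((G.neighborFinset v).erase a).card = 0 ∨
      ((G.neighborFinset v).erase a).card = 1 ∨ ((G.neighborFinset v).erase a).card = 2)
      with e | e | e
    · exact ⟨a, a, by rw [Finset.card_eq_zero.1 e]; simp⟩
    · obtain ⟨b, e⟩ := Finset.card_eq_one.1 e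
      exact ⟨b, b, by simp [e]⟩
    · obtain ⟨b, c, -, e⟩ := Finset.card_eq_two.1 e
      exact ⟨b, c, e.subset⟩
  obtain ⟨b, c, hbc⟩ := h2
  refine ⟨b, c, fun w hw => ?_⟩
  by_cases hwa : w = a
  · exact Or.inl hwa
  · have := hbc (Finset.mem_erase.2 ⟨hwa, (G.mem_neighborFinset v w).2 hw⟩)
    simpa using Or.inr (a := w = a) this

theorem IsGoodColoring.isInjectiveEdgeColoring {Z : Set (Sym2 V)} {c : Sym2 V → Fin 5}
    (h : IsGoodColoring G Z c) : IsInjectiveEdgeColoring G (fun e : G.edgeSet => c e) :=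
  fun u v w x hc => h.ne u v w x hc

theorem eq_or_eq_of_degree_eq_two [G.LocallyFinite] {v a b : V} (h : G.degree v = 2)
    (ha : G.Adj v a) (hb : G.Adj v b) (hab : a ≠ b) (z : V) (hz : G.Adj v z) :
    z = a ∨ z = b := by
  classical
  have : G.neighborFinset v = {a, b} := by
    refine (Finset.eq_of_subset_of_card_le (fun w hw => ?_) ?_).symm
    · rw [Finset.mem_insert, Finset.mem_singleton] at hw
      rcases hw with rfl | rfl <;> simpa
    · rw [card_neighborFinset_eq_degree, h, Finset.card_pair hab]
  have hz' := (G.mem_neighborFinset v z).2 hz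
  rw [this] at hz'
  simpa using hz'

theorem IsGoodColoring.twoColorsOnSimplePaths [G.LocallyFinite] {c : Sym2 V → Fin 5}
    (h : IsGoodColoring G ∅ c) : TwoColorsOnSimplePaths G (fun e : G.edgeSet => c e) := by
  rintro u x p ⟨hp, hdeg⟩ hlen
  obtain _ | ⟨huv, p⟩ := p
  · simp at hlen
  rename_i v
  obtain _ | ⟨hvw, p⟩ := p
  · simp at hlen
  rename_i w
  obtain _ | ⟨hwx, p⟩ := p
  · simp at hlen
  rename_i x'
  obtain _ | ⟨hxy, p⟩ := p
  swap
  · simp at hlen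
  simp only [Walk.isPath_def, Walk.support_cons, Walk.support_nil, List.nodup_cons,
    List.mem_cons, List.not_mem_nil, or_false, not_or] at hp
  obtain ⟨⟨-, huw, hux⟩, ⟨-, hvx⟩, -⟩ := hp
  have hcons : Consecutive G u v w x := ⟨huv, hvw, hwx, huw, hvx⟩
  have hv := hdeg v (by simp) huv.ne' hvx
  have hw := hdeg w (by simp) (Ne.symm huw) hwx.ne
  have hne := h.ne u v w x hcons
  have htwo := h.eq_or_eq u v w x ⟨hcons, hux, eq_or_eq_of_degree_eq_two hv huv.symm hvw huw,
    eq_or_eq_of_degree_eq_two hw hvw.symm hwx hvx⟩ (Set.notMem_empty _)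
  have himage : (fun e : G.edgeSet => c e) '' {e : G.edgeSet | (e : Sym2 V) ∈
      (Walk.cons huv (Walk.cons hvw (Walk.cons hwx Walk.nil))).edges} =
      {c s(u, v), c s(w, x)} := by
    ext k
    simp only [Walk.edges_cons, Walk.edges_nil, Set.mem_image, Set.mem_ofPred_eq, List.mem_cons,
      List.not_mem_nil, or_false, Set.mem_insert_iff, Set.mem_singleton_iff]
    constructor
    · rintro ⟨e, he | he | he, rfl⟩
      · exact Or.inl (by rw [he])
      · rw [he]
        exact htwo
      · exact Or.inr (by rw [he])
    · rintro (rfl | rfl)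
      · exact ⟨⟨s(u, v), huv⟩, Or.inl rfl, rfl⟩
      · exact ⟨⟨s(w, x), hwx⟩, Or.inr (Or.inr rfl), rfl⟩
  rw [himage, Set.ncard_pair hne]

theorem IsOuterplanar.exists_isGoodColoring [Fintype V] [DecidableRel G.Adj]
    (hG : IsOuterplanar G) (hdeg : G.maxDegree ≤ 3) {Z : Set (Sym2 V)}
    (hZ : HitsLongOddCycles G Z) : ∃ c, IsGoodColoring G Z c :=
  _root_.exists_isGoodColoring G (isSubcubic_of_maxDegree hdeg)
    hG.not_hasMinor_completeGraph_four hG.not_hasMinor_two_three hZ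

theorem IsOuterplanar.injChromaticIndex_le_five [Fintype V] [DecidableRel G.Adj]
    (hG : IsOuterplanar G) (hdeg : G.maxDegree ≤ 3) : injChromaticIndex G ≤ 5 := by
  -- With every edge exempt, only injectivity remains and odd cycles cause no obstruction.
  obtain ⟨c, hc⟩ := hG.exists_isGoodColoring hdeg (Z := Set.univ)
    fun _ _ _ _ _ => ⟨0, Set.mem_univ _⟩
  exact iInf₂_le (5 : ℕ) ⟨_, hc.isInjectiveEdgeColoring⟩

end Transfer

/-! ### Straight-line drawings on a parabola -/

section Parabola

variable {V : Type*} {G : SimpleGraph V}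

/-- The point of the parabola `y = x ^ 2` with abscissa `a`. -/
noncomputable def parabolaPoint (a : ℝ) : ℂ := ⟨a, a ^ 2⟩

theorem parabolaPoint_injective : Function.Injective parabolaPoint := fun _ _ h =>
  congrArg Complex.re h

/-- Above abscissa `x`, the chord exceeds the parabola by `(x - a) * (b - x)`; comparing chords
becomes comparing such products. -/
theorem mem_segment_parabolaPoint {a b : ℝ} {z : ℂ}
    (hz : z ∈ segment ℝ (parabolaPoint a) (parabolaPoint b)) (hab : a ≤ b) :
    a ≤ z.re ∧ z.re ≤ b ∧ z.im - z.re ^ 2 = (z.re - a) * (b - z.re) := by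
  obtain ⟨s, t, hs, ht, hst, rfl⟩ := hz
  obtain rfl : s = 1 - t := by linarith
  simp only [parabolaPoint, Complex.add_re, Complex.real_smul, Complex.mul_re, Complex.ofReal_re,
    Complex.ofReal_im, zero_mul, sub_zero, Complex.add_im, Complex.mul_im, add_zero]
  refine ⟨by nlinarith, by nlinarith, by ring⟩

/-- Two noncrossing chords of the parabola meet only in common ends. -/
theorem eq_of_mem_segments {a b c d : ℝ} {z : ℂ} (hab : a < b) (hcd : c < d)
    (hne : ¬ (a = c ∧ b = d)) (hcross : ¬ (a < c ∧ c < b ∧ b < d))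
    (hcross' : ¬ (c < a ∧ a < d ∧ d < b))
    (hz : z ∈ segment ℝ (parabolaPoint a) (parabolaPoint b))
    (hz' : z ∈ segment ℝ (parabolaPoint c) (parabolaPoint d)) :
    (z = parabolaPoint a ∨ z = parabolaPoint b) ∧
      (z = parabolaPoint c ∨ z = parabolaPoint d) := by
  obtain ⟨h1, h2, h3⟩ := mem_segment_parabolaPoint hz hab.le
  obtain ⟨h4, h5, h6⟩ := mem_segment_parabolaPoint hz' hcd.le
  have hend : ∀ {e f : ℝ}, z.im - z.re ^ 2 = (z.re - e) * (f - z.re) →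
      z.re = e ∨ z.re = f → z = parabolaPoint e ∨ z = parabolaPoint f := by
    rintro e f h (h' | h')
    · left
      refine Complex.ext h' ?_
      rw [h'] at h
      simp only [parabolaPoint]
      linarith
    · right
      refine Complex.ext h' ?_
      rw [h'] at h
      simp only [parabolaPoint]
      linarith
  -- For nested chords the difference of heights is a sum of two nonnegative products, so both
  -- vanish at a common point.
  have nested : ∀ {a b c d x : ℝ}, ¬ (a = c ∧ b = d) → a ≤ c → d ≤ b → a ≤ x → x ≤ b → c ≤ x →
      x ≤ d → (x - a) * (b - x) = (x - c) * (d - x) → (x = a ∨ x = b) ∧ (x = c ∨ x = d) := by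
    intro a b c d x hne hac hdb hax hxb hcx hxd e
    have e1 : (c - a) * (b - x) + (x - c) * (b - d) = 0 := by linear_combination e
    have e2 := mul_nonneg (sub_nonneg.2 hac) (sub_nonneg.2 hxb)
    have e3 := mul_nonneg (sub_nonneg.2 hcx) (sub_nonneg.2 hdb)
    have e4 : (c - a) * (b - x) = 0 := by linarith
    have e5 : (x - c) * (b - d) = 0 := by linarith
    rcases mul_eq_zero.1 e4 with h | h <;> rcases mul_eq_zero.1 e5 with h' | h'
    · exact ⟨Or.inl (by linarith), Or.inl (by linarith)⟩
    · exact absurd ⟨by linarith, by linarith⟩ hne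
    · exact ⟨Or.inr (by linarith), Or.inl (by linarith)⟩
    · exact ⟨Or.inr (by linarith), Or.inr (by linarith)⟩
  have heq := h3.symm.trans h6
  suffices h : (z.re = a ∨ z.re = b) ∧ (z.re = c ∨ z.re = d) from
    ⟨hend h3 h.1, hend h6 h.2⟩
  rcases le_or_gt b c with hbc | hbc
  · exact ⟨Or.inr (by linarith), Or.inl (by linarith)⟩
  rcases le_or_gt d a with hda | hda
  · exact ⟨Or.inl (by linarith), Or.inr (by linarith)⟩
  rcases le_or_gt a c with hac | hac
  · rcases le_or_gt d b with hdb | hdb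
    · exact nested hne hac hdb h1 h2 h4 h5 heq
    · rcases hac.lt_or_eq with hac' | hac'
      · exact absurd ⟨hac', hbc, hdb⟩ hcross
      · exact (nested (fun h => hne ⟨h.1.symm, h.2.symm⟩) hac'.ge hdb.le h4 h5 h1 h2
          heq.symm).symm
  · rcases le_or_gt b d with hbd | hbd
    · exact (nested (fun h => hne ⟨h.1.symm, h.2.symm⟩) hac.le hbd h4 h5 h1 h2 heq.symm).symm
    · exact absurd ⟨hac, hda, hbd⟩ hcross'

theorem isArcBetween_segment {a b : ℂ} (h : a ≠ b) : IsArcBetween (segment ℝ a b) a b := by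
  refine ⟨⟨⟨fun t => AffineMap.lineMap a b (t : ℝ), by fun_prop⟩, by simp, by simp⟩, ?_, ?_⟩
  · intro s t hst
    exact Subtype.ext (AffineMap.lineMap_injective ℝ h hst)
  · rw [segment_eq_image_lineMap]
    ext z
    constructor
    · rintro ⟨t, rfl⟩
      exact ⟨t, t.2, rfl⟩
    · rintro ⟨t, ht, rfl⟩
      exact ⟨⟨t, ht⟩, rfl⟩

/-- A graph whose vertices can be ordered such that no two edges cross is outerplanar. -/
theorem isOuterplanar_of_noncrossing (f : V → ℝ) (hf : Function.Injective f)
    (hcross : ∀ a b c d, G.Adj a b → G.Adj c d → ¬ (f a < f c ∧ f c < f b ∧ f b < f d)) :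
    IsOuterplanar G := by
  let pt : V → ℂ := fun v => parabolaPoint (f v)
  have hpt : Function.Injective pt := parabolaPoint_injective.comp hf
  let arc : Sym2 V → Set ℂ := Sym2.lift ⟨fun u v => segment ℝ (pt u) (pt v),
    fun u v => segment_symm ℝ _ _⟩
  have harc : ∀ u v, arc s(u, v) = segment ℝ (pt u) (pt v) := fun u v => rfl
  have horient : ∀ e ∈ G.edgeSet, ∃ u v, e = s(u, v) ∧ G.Adj u v ∧ f u < f v := by
    rintro ⟨u, v⟩ he
    rcases lt_or_gt_of_ne (fun h => G.ne_of_adj he (hf h)) with h | h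
    · exact ⟨u, v, rfl, he, h⟩
    · exact ⟨v, u, Sym2.eq_swap, Adj.symm he, h⟩
  have habove : ∀ e ∈ G.edgeSet, ∀ z ∈ arc e, z.re ^ 2 ≤ z.im := by
    intro e he z hz
    obtain ⟨u, v, rfl, -, huv⟩ := horient e he
    obtain ⟨h1, h2, h3⟩ := mem_segment_parabolaPoint (harc u v ▸ hz) huv.le
    nlinarith [mul_nonneg (sub_nonneg.2 h1) (sub_nonneg.2 h2)]
  let D : PlanarDrawing G :=
    { point := pt
      arc := arc
      point_injective := hpt
      isArc := fun u v huv => isArcBetween_segment (hpt.ne huv.ne)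
      mem_of_point_mem_arc := by
        intro e he w hw
        obtain ⟨u, v, rfl, -, huv⟩ := horient e he
        obtain ⟨h1, h2, h3⟩ := mem_segment_parabolaPoint (harc u v ▸ hw) huv.le
        simp only [pt, parabolaPoint, sub_self] at h1 h2 h3
        rw [Sym2.mem_iff]
        rcases mul_eq_zero.1 h3.symm with h | h
        · exact Or.inl (hf (by linarith))
        · exact Or.inr (hf (by linarith))
      arc_inter_arc := by
        rintro e he e' he' hne z ⟨hz, hz'⟩
        obtain ⟨a, b, rfl, hab, hab'⟩ := horient e he
        obtain ⟨c, d, rfl, hcd, hcd'⟩ := horient e' he'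
        obtain ⟨h1, h2⟩ := eq_of_mem_segments hab' hcd'
          (fun h => hne (by rw [hf h.1, hf h.2])) (hcross a b c d hab hcd)
          (hcross c d a b hcd hab) hz hz'
        obtain ⟨w, hw, rfl⟩ : ∃ w ∈ s(a, b), z = pt w := by
          rcases h1 with h | h
          · exact ⟨a, by simp, h⟩
          · exact ⟨b, by simp, h⟩
        refine ⟨w, ⟨hw, ?_⟩, rfl⟩
        rcases h2 with h | h
        · rw [hpt h]
          simp
        · rw [hpt h]
          simp }
  -- The region below the parabola is connected and unbounded, misses the drawing and has every
  -- vertex in its closure. Hence it lies in the outer face.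
  let B : Set ℂ := {z | z.im < z.re ^ 2}
  have hcarrier : ∀ z ∈ D.carrier, z.re ^ 2 ≤ z.im := by
    rintro z (⟨v, rfl⟩ | hz)
    · exact le_rfl
    · obtain ⟨e, he, hz⟩ := Set.mem_iUnion₂.1 hz
      exact habove e he z hz
  have hBc : B ⊆ D.carrierᶜ := fun z hz hz' => absurd (hcarrier z hz') (not_le.2 hz)
  have hBp : IsPreconnected B := by
    have : B = (fun x : ℝ × ℝ => (⟨x.1, x.1 ^ 2 + x.2⟩ : ℂ)) '' (Set.univ ×ˢ Set.Iio 0) := by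
      ext z
      constructor
      · intro hz
        refine ⟨(z.re, z.im - z.re ^ 2), ⟨Set.mem_univ _, Set.mem_Iio.2 (sub_neg.2 hz)⟩, ?_⟩
        exact Complex.ext rfl (by simp)
      · rintro ⟨⟨x, y⟩, ⟨-, hy⟩, rfl⟩
        simpa [B] using hy
    rw [this]
    refine (isPreconnected_univ.prod isPreconnected_Iio).image _ (Continuous.continuousOn ?_)
    have : (fun x : ℝ × ℝ => (⟨x.1, x.1 ^ 2 + x.2⟩ : ℂ)) =
        fun x => (x.1 : ℂ) + ((x.1 ^ 2 + x.2 : ℝ) : ℂ) * Complex.I := by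
      funext x
      exact Complex.mk_eq_add_mul_I _ _
    rw [this]
    fun_prop
  have hz₀ : (⟨0, -1⟩ : ℂ) ∈ B := by simp [B]
  have hBF : B ⊆ connectedComponentIn D.carrierᶜ ⟨0, -1⟩ :=
    hBp.subset_connectedComponentIn hz₀ hBc
  refine ⟨D, connectedComponentIn D.carrierᶜ ⟨0, -1⟩, ⟨⟨_, hBc hz₀, rfl⟩, fun hb => ?_⟩,
    fun v => ?_⟩
  · obtain ⟨R, hR⟩ := hb.exists_norm_le
    have h1 := hR ⟨0, -(|R| + 1)⟩ (hBF (by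
      simp only [B, Set.mem_ofPred_eq]
      have := abs_nonneg R
      nlinarith))
    have h2 := (Complex.abs_im_le_norm _).trans h1
    simp only [abs_neg] at h2
    rw [abs_of_pos (by positivity)] at h2
    linarith [le_abs_self R]
  · refine ⟨?_, fun hint => ?_⟩
    · refine closure_mono hBF (Metric.mem_closure_iff.2 fun ε hε => ?_)
      refine ⟨⟨f v, f v ^ 2 - ε / 2⟩, by simp [B, hε], ?_⟩
      have : D.point v - ⟨f v, f v ^ 2 - ε / 2⟩ = ((ε / 2 : ℝ) : ℂ) * Complex.I := by
        apply Complex.ext <;> simp [D, pt, parabolaPoint]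
      rw [Complex.dist_eq, this]
      simp only [Complex.norm_mul, Complex.norm_I, mul_one, Complex.norm_real, Real.norm_eq_abs]
      rw [abs_of_pos (by positivity)]
      linarith
    · exact connectedComponentIn_subset _ _ (interior_subset hint) (Or.inl ⟨v, rfl⟩)

end Parabola

/-! ### The extremal graph -/

section TwelveGraph

/-- The position of the vertices of the extremal graph on the boundary of the outer face. -/
def twelvePosition : Fin 12 → ℕ := ![5, 0, 4, 3, 2, 1, 6, 7, 11, 10, 9, 8]

theorem twelvePosition_pair_mem : ∀ a b, twelveGraph.Adj a b →
    twelvePosition a < twelvePosition b → (twelvePosition a, twelvePosition b) ∈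
      [(5, 6), (0, 5), (4, 5), (0, 4), (0, 1), (3, 4), (1, 3), (2, 3), (1, 2),
        (6, 7), (6, 11), (7, 11), (7, 8), (10, 11), (8, 10), (9, 10), (8, 9)] := by
  decide

theorem twelveGraph_noncrossing (a b c d : Fin 12) (hab : twelveGraph.Adj a b)
    (hcd : twelveGraph.Adj c d) : ¬ (twelvePosition a < twelvePosition c ∧
      twelvePosition c < twelvePosition b ∧ twelvePosition b < twelvePosition d) := by
  rintro ⟨h1, h2, h3⟩
  have hab' := twelvePosition_pair_mem a b hab (h1.trans h2)
  have hcd' := twelvePosition_pair_mem c d hcd (h2.trans h3)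
  generalize twelvePosition a = a' at *
  generalize twelvePosition b = b' at *
  generalize twelvePosition c = c' at *
  generalize twelvePosition d = d' at *
  simp only [List.mem_cons, Prod.mk.injEq, List.not_mem_nil, or_false] at hab' hcd'
  omega

theorem isOuterplanar_twelveGraph : IsOuterplanar twelveGraph := by
  refine isOuterplanar_of_noncrossing (fun v => (twelvePosition v : ℝ)) ?_ ?_
  · have : Function.Injective twelvePosition := by decide
    exact Nat.cast_injective.comp this
  · intro a b c d hab hcd
    exact_mod_cast twelveGraph_noncrossing a b c d hab hcd

theorem twelveGraph_maxDegree : twelveGraph.maxDegree = 3 := by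
  refine le_antisymm (twelveGraph.maxDegree_le_of_forall_degree_le 3 (by decide)) ?_
  have : twelveGraph.degree 0 = 3 := by decide
  exact this ▸ twelveGraph.degree_le_maxDegree 0

theorem Fin.eq_of_ne_of_four : ∀ {a b c x y : Fin 4}, a ≠ b → a ≠ c → b ≠ c → x ≠ a → x ≠ b →
    x ≠ c → y ≠ a → y ≠ b → y ≠ c → y = x := by
  decide

/-- In an injective edge-coloring with four colors of one half of the extremal graph, the color of
the pendant edge appears on another edge at its end. -/
theorem color_bridge_eq {r α β γ δ ε ζ η θ : Fin 4} (hαβ : α ≠ β) (hαγ : α ≠ γ) (hβγ : β ≠ γ)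
    (hζγ : ζ ≠ γ) (hζα : ζ ≠ α) (hζβ : ζ ≠ β) (hθα : θ ≠ α) (hθγ : θ ≠ γ) (hζη : ζ ≠ η)
    (hζθ : ζ ≠ θ) (hηγ : η ≠ γ) (hηβ : η ≠ β) (hδβ : δ ≠ β) (hδη : δ ≠ η)
    (hεα : ε ≠ α) (hεθ : ε ≠ θ) (hδε : δ ≠ ε) (hrγ : r ≠ γ) (hrδ : r ≠ δ) (hrε : r ≠ ε) :
    r = α ∨ r = β := by
  -- The first triangle uses three colors, and `ζ` must be the fourth. This forces `θ = β` and `η =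
  -- α`, so the distinct colors `δ` and `ε` exhaust `{γ, ζ}`. Only `α` and `β` are left for `r`.
  have hθ : β = θ := Fin.eq_of_ne_of_four hζα.symm hαγ hζγ hθα (Ne.symm hζθ) hθγ hαβ.symm
    hζβ.symm hβγ
  have hη : α = η := Fin.eq_of_ne_of_four hζβ.symm hβγ hζγ hηβ (Ne.symm hζη) hηγ hαβ
    hζα.symm hαγ
  subst hθ hη
  by_contra! hr
  have hζr : ζ = r := Fin.eq_of_ne_of_four hαβ hαγ hβγ hr.1 hr.2 hrγ hζα hζβ hζγ
  subst hζr
  have h1 : γ = δ := Fin.eq_of_ne_of_four hαβ hζα.symm hζβ.symm hδη hδβ hrδ.symm hαγ.symm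
    hβγ.symm hζγ.symm
  have h2 : γ = ε := Fin.eq_of_ne_of_four hαβ hζα.symm hζβ.symm hεα hεθ hrε.symm hαγ.symm
    hβγ.symm hζγ.symm
  exact hδε (h1.symm.trans h2)

theorem twelveGraph_not_four (c : Sym2 (Fin 12) → Fin 4)
    (hc : ∀ u v w x, Consecutive twelveGraph u v w x → c s(u, v) ≠ c s(w, x)) : False := by
  have sw : ∀ a b, c s(a, b) = c s(b, a) := fun a b => by rw [Sym2.eq_swap]
  have half : ∀ x y a₁ a₂ a₃ a₄ a₅ : Fin 12, y ≠ x → y ≠ a₁ → y ≠ a₂ → x ≠ a₁ → x ≠ a₂ → x ≠ a₃ →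
      x ≠ a₅ → a₁ ≠ a₂ → a₁ ≠ a₃ → a₁ ≠ a₄ → a₁ ≠ a₅ → a₂ ≠ a₃ → a₂ ≠ a₄ → a₂ ≠ a₅ →
      a₃ ≠ a₄ → a₃ ≠ a₅ → a₄ ≠ a₅ → twelveGraph.Adj y x → twelveGraph.Adj x a₁ →
      twelveGraph.Adj x a₂ → twelveGraph.Adj a₁ a₂ → twelveGraph.Adj a₁ a₅ →
      twelveGraph.Adj a₂ a₃ → twelveGraph.Adj a₃ a₅ → twelveGraph.Adj a₃ a₄ →
      twelveGraph.Adj a₄ a₅ → c s(y, x) = c s(x, a₁) ∨ c s(y, x) = c s(x, a₂) := by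
    intro x y a₁ a₂ a₃ a₄ a₅ n1 n2 n3 n4 n5 n6 n7 n8 n9 n10 n11 n12 n13 n14 n15 n16 n17
      yx x1 x2 e12 e15 e23 e35 e34 e45
    refine color_bridge_eq (γ := c s(a₁, a₂)) (δ := c s(a₁, a₅)) (ε := c s(a₂, a₃))
      (ζ := c s(a₃, a₅)) (η := c s(a₃, a₄)) (θ := c s(a₄, a₅)) ?_ ?_ ?_ ?_ ?_ ?_ ?_ ?_ ?_ ?_ ?_ ?_
      ?_ ?_ ?_ ?_ ?_ ?_ ?_ ?_
    · rw [sw x a₂]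
      exact hc x a₁ a₂ x ⟨x1, e12, x2.symm, n5, n4.symm⟩
    · rw [sw x a₁, sw a₁ a₂]
      exact hc a₁ x a₂ a₁ ⟨x1.symm, x2, e12.symm, n8, n4⟩
    · rw [sw x a₂]
      exact hc a₂ x a₁ a₂ ⟨x2.symm, x1, e12, n8.symm, n5⟩
    · have := hc a₂ a₁ a₅ a₃ ⟨e12.symm, e15, e35.symm, n14, n9⟩
      rw [sw a₅ a₃, sw a₂ a₁] at this
      exact this.symm
    · have := hc x a₁ a₅ a₃ ⟨x1, e15, e35.symm, n7, n9⟩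
      rw [sw a₅ a₃] at this
      exact this.symm
    · exact (hc x a₂ a₃ a₅ ⟨x2, e23, e35, n6, n14⟩).symm
    · have := hc x a₁ a₅ a₄ ⟨x1, e15, e45.symm, n7, n10⟩
      rw [sw a₅ a₄] at this
      exact this.symm
    · have := hc a₂ a₁ a₅ a₄ ⟨e12.symm, e15, e45.symm, n14, n10⟩
      rw [sw a₅ a₄, sw a₂ a₁] at this
      exact this.symm
    · have := hc a₃ a₅ a₄ a₃ ⟨e35, e45.symm, e34.symm, n15, n16.symm⟩
      rwa [sw a₄ a₃] at this
    · have := hc a₅ a₃ a₄ a₅ ⟨e35.symm, e34, e45, n17.symm, n16⟩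
      rwa [sw a₅ a₃] at this
    · exact (hc a₁ a₂ a₃ a₄ ⟨e12, e23, e34, n9, n13⟩).symm
    · exact (hc x a₂ a₃ a₄ ⟨x2, e23, e34, n6, n13⟩).symm
    · have := hc a₂ x a₁ a₅ ⟨x2.symm, x1, e15, n8.symm, n7⟩
      rw [sw a₂ x] at this
      exact this.symm
    · have := hc a₁ a₅ a₄ a₃ ⟨e15, e45.symm, e34.symm, n10, n16.symm⟩
      rwa [sw a₄ a₃] at this
    · have := hc a₁ x a₂ a₃ ⟨x1.symm, x2, e23, n8, n6⟩
      rw [sw a₁ x] at this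
      exact this.symm
    · exact hc a₂ a₃ a₄ a₅ ⟨e23, e34, e45, n13, n16⟩
    · have := hc a₅ a₁ a₂ a₃ ⟨e15.symm, e12, e23, n14.symm, n9⟩
      rwa [sw a₅ a₁] at this
    · exact hc y x a₁ a₂ ⟨yx, x1, e12, n2, n5⟩
    · exact hc y x a₁ a₅ ⟨yx, x1, e15, n2, n7⟩
    · exact hc y x a₂ a₃ ⟨yx, x2, e23, n3, n6⟩
  have h1 := half 0 6 1 2 3 4 5 (by decide) (by decide) (by decide) (by decide) (by decide)
    (by decide) (by decide) (by decide) (by decide) (by decide) (by decide) (by decide)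
    (by decide) (by decide) (by decide) (by decide) (by decide) (by decide) (by decide)
    (by decide) (by decide) (by decide) (by decide) (by decide) (by decide) (by decide)
  have h2 := half 6 0 7 8 9 10 11 (by decide) (by decide) (by decide) (by decide) (by decide)
    (by decide) (by decide) (by decide) (by decide) (by decide) (by decide) (by decide)
    (by decide) (by decide) (by decide) (by decide) (by decide) (by decide) (by decide)
    (by decide) (by decide) (by decide) (by decide) (by decide) (by decide) (by decide)
  rw [sw 6 0] at h1
  -- An edge at each end of the bridge forms consecutive edges with it, so the two cannot both
  -- repeat its color.
  have k : ∀ a b, twelveGraph.Adj 0 a → twelveGraph.Adj 6 b → a ≠ 6 → b ≠ 0 →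
      c s(0, a) ≠ c s(6, b) := fun a b ha hb h h' => by
    rw [sw 0 a]
    exact hc a 0 6 b ⟨ha.symm, by decide, hb, h, h'.symm⟩
  rcases h1 with h1 | h1 <;> rcases h2 with h2 | h2
  · exact k 1 7 (by decide) (by decide) (by decide) (by decide) (h1.symm.trans h2)
  · exact k 1 8 (by decide) (by decide) (by decide) (by decide) (h1.symm.trans h2)
  · exact k 2 7 (by decide) (by decide) (by decide) (by decide) (h1.symm.trans h2)
  · exact k 2 8 (by decide) (by decide) (by decide) (by decide) (h1.symm.trans h2)

theorem five_le_injChromaticIndex_twelveGraph : 5 ≤ injChromaticIndex twelveGraph := by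
  classical
  refine le_iInf₂ fun k hk => ?_
  obtain ⟨c, hc⟩ := hk
  by_contra hlt
  have hk4 : k ≤ 4 := by
    have : k < 5 := by exact_mod_cast not_le.1 hlt
    omega
  refine twelveGraph_not_four (fun e => if he : e ∈ twelveGraph.edgeSet then
    Fin.castLE hk4 (c ⟨e, he⟩) else 0) fun u v w x h => ?_
  rw [dif_pos (show s(u, v) ∈ twelveGraph.edgeSet from h.1),
    dif_pos (show s(w, x) ∈ twelveGraph.edgeSet from h.2.2.1)]
  exact fun e => hc u v w x h (Fin.castLE_injective hk4 e)

end TwelveGraph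

theorem theorem1p19 :
    (∀ (V : Type*) [Fintype V] (G : SimpleGraph V) [DecidableRel G.Adj],
      IsOuterplanar G → G.maxDegree = 3 →
        injChromaticIndex G ≤ 5 ∧
        (NoLongOddCycleComponent G →
          ∃ c : G.edgeSet → Fin 5,
            IsInjectiveEdgeColoring G c ∧ TwoColorsOnSimplePaths G c)) ∧
    (IsOuterplanar twelveGraph ∧ twelveGraph.maxDegree = 3 ∧
      injChromaticIndex twelveGraph = 5) := by
  refine ⟨fun V _ G _ hG hdeg => ⟨hG.injChromaticIndex_le_five hdeg.le, fun hno => ?_⟩,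
    isOuterplanar_twelveGraph, twelveGraph_maxDegree,
    le_antisymm (isOuterplanar_twelveGraph.injChromaticIndex_le_five twelveGraph_maxDegree.le)
      five_le_injChromaticIndex_twelveGraph⟩
  obtain ⟨c, hc⟩ := hG.exists_isGoodColoring hdeg.le (hno.hitsLongOddCycles ∅)
  exact ⟨_, hc.isInjectiveEdgeColoring, hc.twoColorsOnSimplePaths⟩
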